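/- For a set $B$ of variables of a CNF formula $F$ and an assignment $\tau\colon B\to\{0,1\}$, the simplification $F[\tau]$ is obtained from $F$ by deleting every clause that contains a literal made true by $\tau$ and deleting from the remaining clauses all literals over $B$. Let $E$ be the class whose only member is the empty formula (the formula without clauses). A set $B$ of variables of $F$ is a weak $E$-backdoor of $F$ if there is an assignment $\tau$ to $B$ such that $F[\tau]$ is satisfiable and belongs to $E$. Theorem. Consider the parameterized problem: given a CNF formula $F$ and the parameter $k\in\mathbb{N}$, decide whether $F$ has a weak $E$-backdoor of size at most $k$. (1) For general CNF formulas the problem is $W[2]$-complete under fpt-reductions: it belongs to $W[2]$, and every problem in $W[2]$ is fpt-reducible to it. Moreover, the Hitting Set problem (given a finite family of finite sets and the parameter $k$, is there a set of at most $k$ elements that meets every member of the family?) is fpt-reducible to it. (2) For every constant $d\ge 1$, the problem restricted to $d$-CNF formulas (every clause has at most $d$ literals) is fixed-parameter tractable; more precisely, it is solved by an algorithm with running time $O^*(d^k)$, that is, $O(d^k\, n^c)$ for some constant $c$, where $n$ is the size of the input. -/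

import Mathlib

namespace ParamComplexity

/-! ### Data values and a programming language with a cost measure -/

/-- Data values: binary trees without labels (the data type of the `WHILE` language).
They play the role of words: instances and variable names are data values. -/
inductive Val : Type
  | nil : Val
  | cons : Val → Val → Val
  deriving DecidableEq

namespace Val

/-- The number of nodes of a data value. -/
def size : Val → ℕ
  | nil => 1
  | cons a b => a.size + b.size + 1

/-- First component (`nil` for `nil`). -/
def hd : Val → Val
  | nil => nil
  | cons a _ => a

/-- Second component (`nil` for `nil`). -/
def tl : Val → Val
  | nil => nil
  | cons _ b => b

/-- Every data value is read as a list: `nil` is the empty list, `cons a b` is `a` followed by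
the list `b`. This is a bijection between data values and lists of data values. -/
def toList : Val → List Val
  | nil => []
  | cons a b => a :: b.toList

/-- The data value that represents a given list. -/
def ofList : List Val → Val
  | [] => nil
  | a :: l => cons a (ofList l)

/-- The unary representation of a natural number. -/
def ofNat : ℕ → Val
  | 0 => nil
  | n + 1 => cons nil (ofNat n)

end Val

/-- Programs. Each program transforms one data value into one data value. -/
inductive Prog : Type
  /-- the constant `nil` -/
  | nil : Prog
  /-- the identity -/
  | skip : Prog
  /-- the first component -/
  | hd : Prog
  /-- the second component -/
  | tl : Prog
  /-- equality test of the two components (`cons nil nil` for yes, `nil` for no) -/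
  | eq : Prog
  /-- run both programs on the input and form the pair of the results -/
  | pair : Prog → Prog → Prog
  /-- run the first program, then run the second one on its result -/
  | seq : Prog → Prog → Prog
  /-- `cond c p q`: if `c` returns a value other than `nil`, then run `p`, otherwise run `q` -/
  | cond : Prog → Prog → Prog → Prog
  /-- `loop c p`: as long as `c` returns a value other than `nil`, replace the current value by
  the result of `p` on it -/
  | loop : Prog → Prog → Prog

open Val in
/-- `Runs p x y t`: on input `x` the program `p` halts with output `y` after `t` time units.
An elementary operation on `x` costs `size x + 2` time units, and every other construct costs one
unit in addition to the costs of its parts. The time of every run is therefore at least the size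
of its input and of its output, as for a Turing machine that has to read and to write all its
data; up to polynomial factors in the size of the data that occur, this is Turing machine time. -/
inductive Runs : Prog → Val → Val → ℕ → Prop
  | nil (x : Val) : Runs Prog.nil x Val.nil (x.size + 2)
  | skip (x : Val) : Runs Prog.skip x x (x.size + 2)
  | hd (x : Val) : Runs Prog.hd x x.hd (x.size + 2)
  | tl (x : Val) : Runs Prog.tl x x.tl (x.size + 2)
  | eq (x : Val) :
      Runs Prog.eq x (if x.hd = x.tl then Val.cons Val.nil Val.nil else Val.nil) (x.size + 2)
  | pair {p q : Prog} {x y z : Val} {s t : ℕ} (hp : Runs p x y s) (hq : Runs q x z t) :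
      Runs (Prog.pair p q) x (Val.cons y z) (s + t + 1)
  | seq {p q : Prog} {x y z : Val} {s t : ℕ} (hp : Runs p x y s) (hq : Runs q y z t) :
      Runs (Prog.seq p q) x z (s + t + 1)
  | cond_true {c p q : Prog} {x b y : Val} {s t : ℕ} (hc : Runs c x b s) (hb : b ≠ Val.nil)
      (hp : Runs p x y t) : Runs (Prog.cond c p q) x y (s + t + 1)
  | cond_false {c p q : Prog} {x y : Val} {s t : ℕ} (hc : Runs c x Val.nil s)
      (hq : Runs q x y t) : Runs (Prog.cond c p q) x y (s + t + 1)
  | loop_stop {c p : Prog} {x : Val} {s : ℕ} (hc : Runs c x Val.nil s) :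
      Runs (Prog.loop c p) x x (s + 1)
  | loop_step {c p : Prog} {x b y z : Val} {s t u : ℕ} (hc : Runs c x b s) (hb : b ≠ Val.nil)
      (hp : Runs p x y t) (hl : Runs (Prog.loop c p) y z u) :
      Runs (Prog.loop c p) x z (s + t + u + 1)

/-! ### Parameterized problems, fixed-parameter tractability, fpt-reductions -/

/-- A parameterized problem: a set of pairs (instance, parameter). -/
abbrev ParamProblem : Type := Set (Val × ℕ)

/-- The input that a program receives for the instance `x` with parameter `k`. The parameter is
written in unary, so that the size of the input is that of `x` plus a linear function of `k`. -/
def input (x : Val) (k : ℕ) : Val := Val.cons x (Val.ofNat k)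

/-- `P` is decided by an algorithm with running time `O*(f(k))`, that is, `O(f(k) * n ^ c)` for a
constant `c`, where `n` is the size of the input. -/
def SolvableInOStar (P : ParamProblem) (f : ℕ → ℕ) : Prop :=
  ∃ (p : Prog) (C c : ℕ), ∀ (x : Val) (k : ℕ), ∃ (y : Val) (t : ℕ),
    Runs p (input x k) y t ∧ t ≤ C * f k * (input x k).size ^ c ∧ (y ≠ Val.nil ↔ (x, k) ∈ P)

/-- Fixed-parameter tractability: running time `O*(f(k))` for some computable `f`. -/
def IsFPT (P : ParamProblem) : Prop :=
  ∃ f : ℕ → ℕ, Computable f ∧ SolvableInOStar P f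

/-- `P` is fpt-reducible (many-one) to `Q`: some algorithm maps each instance `(x, k)` in time
`f(k) * n ^ c` to an equivalent instance `(y, k')` with `k' ≤ g(k)`, where `f` and `g` are
computable and `n` is the size of the input. -/
def FPTReduces (P Q : ParamProblem) : Prop :=
  ∃ (p : Prog) (f g : ℕ → ℕ) (c : ℕ), Computable f ∧ Computable g ∧
    ∀ (x : Val) (k : ℕ), ∃ (y : Val) (k' t : ℕ),
      Runs p (input x k) (input y k') t ∧ t ≤ f k * (input x k).size ^ c ∧ k' ≤ g k ∧
        ((x, k) ∈ P ↔ (y, k') ∈ Q)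

/-! ### The class W[2], through weighted Fagin definability by `Π₂` formulas -/

/-- A finite relational vocabulary. -/
structure Vocabulary : Type where
  /-- the number of relation symbols -/
  num : ℕ
  /-- the arities of the relation symbols -/
  arity : Fin num → ℕ

/-- A finite relational structure whose elements are named by data values. -/
structure FinStructure (τ : Vocabulary) : Type where
  /-- the universe -/
  univ : Finset Val
  univ_nonempty : univ.Nonempty
  /-- the relations -/
  rel : (R : Fin τ.num) → Set (Fin (τ.arity R) → Val)
  rel_subset : ∀ R, ∀ a ∈ rel R, ∀ i, a i ∈ univ

/-- Quantifier-free first-order formulas over the vocabulary `τ` and one more relation symbol `X`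
of arity `s` (the free relation variable), with individual variables in `ν`. -/
inductive QF (τ : Vocabulary) (s : ℕ) (ν : Type) : Type
  | eq : ν → ν → QF τ s ν
  | rel : (R : Fin τ.num) → (Fin (τ.arity R) → ν) → QF τ s ν
  | X : (Fin s → ν) → QF τ s ν
  | not : QF τ s ν → QF τ s ν
  | and : QF τ s ν → QF τ s ν → QF τ s ν
  | or : QF τ s ν → QF τ s ν → QF τ s ν

/-- Satisfaction of a quantifier-free formula. -/
def QF.Holds {τ : Vocabulary} {s : ℕ} {ν : Type} (A : FinStructure τ)
    (S : Finset (Fin s → Val)) (v : ν → Val) : QF τ s ν → Prop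
  | .eq i j => v i = v j
  | .rel R a => (fun i => v (a i)) ∈ A.rel R
  | .X a => (fun i => v (a i)) ∈ S
  | .not φ => ¬ φ.Holds A S v
  | .and φ ψ => φ.Holds A S v ∧ ψ.Holds A S v
  | .or φ ψ => φ.Holds A S v ∨ ψ.Holds A S v

/-- A `Π₂` formula `φ(X) = ∀ x₁ … x_p ∃ y₁ … y_q, ψ` with quantifier-free `ψ` and one free
relation variable `X`. -/
structure Pi2Formula : Type where
  /-- the vocabulary -/
  voc : Vocabulary
  /-- the arity of the free relation variable -/
  arityX : ℕ
  /-- the number of universally quantified variables -/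
  p : ℕ
  /-- the number of existentially quantified variables -/
  q : ℕ
  /-- the quantifier-free part -/
  matrix : QF voc arityX (Fin p ⊕ Fin q)

/-- `A ⊨ φ(S)`. -/
def Pi2Formula.Holds (φ : Pi2Formula) (A : FinStructure φ.voc)
    (S : Finset (Fin φ.arityX → Val)) : Prop :=
  ∀ a : Fin φ.p → Val, (∀ i, a i ∈ A.univ) →
    ∃ b : Fin φ.q → Val, (∀ i, b i ∈ A.univ) ∧ φ.matrix.Holds A S (Sum.elim a b)

/-- The structure that a data value represents: the first component lists the universe (only
here, `nil` is read as the list with the single entry `nil`, because a universe is nonempty), the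
second component lists the relations, each of them as a list of tuples. Missing relations are
empty, and tuples of wrong length or with entries outside the universe are ignored. -/
def Val.toStructure (τ : Vocabulary) (x : Val) : FinStructure τ where
  univ := (x.hd.hd :: x.hd.tl.toList).toFinset
  univ_nonempty := ⟨x.hd.hd, by simp⟩
  rel R := {a | (∀ i, a i ∈ (x.hd.hd :: x.hd.tl.toList).toFinset) ∧
    List.ofFn a ∈ ((x.tl.toList.getD (R : ℕ) Val.nil).toList.map Val.toList)}
  rel_subset := fun _ _ h => h.1

/-- The weighted Fagin definability problem of `φ(X)`: given a finite structure `A` and the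
parameter `k`, is there a relation `S` of cardinality exactly `k` on the universe of `A` such that
`A ⊨ φ(S)`? -/
def weightedDef (φ : Pi2Formula) : ParamProblem :=
  {i | ∃ S : Finset (Fin φ.arityX → Val),
    (∀ a ∈ S, ∀ j, a j ∈ (i.1.toStructure φ.voc).univ) ∧ S.card = i.2 ∧
      φ.Holds (i.1.toStructure φ.voc) S}

/-- The class W[2]: the closure under fpt-reductions of the weighted Fagin definability problems
of `Π₂` formulas. -/
def W2 : Set ParamProblem := {P | ∃ φ : Pi2Formula, FPTReduces P (weightedDef φ)}

/-- W[2]-completeness under fpt-reductions. -/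
def IsW2Complete (P : ParamProblem) : Prop := P ∈ W2 ∧ ∀ Q ∈ W2, FPTReduces Q P

/-! ### CNF formulas and backdoors -/

/-- A literal: a variable and its sign (`true` for the positive literal). -/
abbrev Literal (V : Type) : Type := V × Bool

/-- A clause is a finite set of literals. -/
abbrev Clause (V : Type) : Type := Finset (Literal V)

/-- A CNF formula is a finite set of clauses. -/
abbrev CNF (V : Type) : Type := Finset (Clause V)

namespace CNF

/-- The variables of a formula. -/
def vars {V : Type} [DecidableEq V] (F : CNF V) : Finset V :=
  F.biUnion fun c => c.image Prod.fst

/-- Satisfiability. -/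
def Satisfiable {V : Type} (F : CNF V) : Prop :=
  ∃ σ : V → Bool, ∀ c ∈ F, ∃ l ∈ c, σ l.1 = l.2

/-- The simplification of `F` by the assignment `τ` to the variables in `B` (values of `τ` outside
`B` play no role): clauses with a true literal are removed, and false literals are removed from
the other clauses. -/
def simplify {V : Type} [DecidableEq V] (F : CNF V) (B : Finset V) (τ : V → Bool) : CNF V :=
  (F.filter fun c => ¬ ∃ l ∈ c, l.1 ∈ B ∧ τ l.1 = l.2).image
    fun c => c.filter fun l => l.1 ∉ B

/-- `B` is a weak `C`-backdoor of `F`: a set of variables of `F` such that for some assignment to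
`B` the simplified formula is satisfiable and belongs to the class `C`. -/
def IsWeakBackdoor {V : Type} [DecidableEq V] (C : Set (CNF V)) (F : CNF V) (B : Finset V) :
    Prop :=
  B ⊆ F.vars ∧ ∃ τ : V → Bool, (F.simplify B τ).Satisfiable ∧ F.simplify B τ ∈ C

/-- The class `E` whose only member is the empty formula (no clauses). -/
def emptyClass (V : Type) : Set (CNF V) := {∅}

/-- Every clause has at most `d` literals. -/
def IsDCNF {V : Type} (d : ℕ) (F : CNF V) : Prop := ∀ c ∈ F, c.card ≤ d

end CNF

/-- The literal that a data value represents: the second component is the name of the variable,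
and the literal is negative if the first component is `nil` and positive otherwise. -/
def Val.toLiteral (x : Val) : Literal Val := (x.tl, decide (x.hd ≠ Val.nil))

/-- The CNF formula that a data value represents: a list of lists of literals. -/
def Val.toCNF (x : Val) : CNF Val :=
  (x.toList.map fun c => (c.toList.map Val.toLiteral).toFinset).toFinset

/-- Weak `E`-backdoor for general CNF formulas: given `F` and the parameter `k`, does `F` have a
weak `E`-backdoor of size at most `k`? -/
def weakEBackdoor : ParamProblem :=
  {i | ∃ B : Finset Val, B.card ≤ i.2 ∧ i.1.toCNF.IsWeakBackdoor (CNF.emptyClass Val) B}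

/-- Weak `E`-backdoor for `d`-CNF formulas. -/
def weakEBackdoorDCNF (d : ℕ) : ParamProblem :=
  {i | i.1.toCNF.IsDCNF d ∧ i ∈ weakEBackdoor}

/-! ### Hitting Set -/

/-- The finite family of finite sets that a data value represents. -/
def Val.toFamily (x : Val) : Finset (Finset Val) :=
  (x.toList.map fun c => c.toList.toFinset).toFinset

/-- Hitting Set: given a finite family of finite sets and the parameter `k`, is there a set of at
most `k` elements that meets every member of the family? -/
def hittingSet : ParamProblem :=
  {i | ∃ H : Finset Val, H.card ≤ i.2 ∧ ∀ s ∈ i.1.toFamily, (s ∩ H).Nonempty}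

/-! ### Every formula has a code -/

theorem Val.toList_ofList (l : List Val) : (Val.ofList l).toList = l := by
  induction l with
  | nil => rfl
  | cons a l ih => simp [Val.ofList, Val.toList, ih]

theorem Val.toLiteral_surjective : Function.Surjective Val.toLiteral := by
  rintro ⟨v, b⟩
  refine ⟨Val.cons (if b then Val.cons Val.nil Val.nil else Val.nil) v, ?_⟩
  cases b <;> simp [Val.toLiteral, Val.hd, Val.tl]

theorem Val.toCNF_surjective : Function.Surjective Val.toCNF := by
  choose g hg using Val.toLiteral_surjective
  intro F
  have h : Val.toLiteral ∘ g = id := funext hg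
  refine ⟨Val.ofList (F.toList.map fun c => Val.ofList (c.toList.map g)), ?_⟩
  simp [Val.toCNF, Val.toList_ofList, Function.comp_def, hg]

end ParamComplexity

namespace ParamComplexity

/-! ### Encodings of types by data values, and polynomial time functions -/

/-! An assignment to `B` removes every clause exactly when it satisfies every clause. So a weak
`E`-backdoor of size at most `k` amounts to a consistent set of at most `k` literals that meets
every clause (`CNF.exists_isWeakBackdoor_iff`). If all literals are positive, consistency is vacuous
and what remains is Hitting Set (`positiveCNF_mem_weakEBackdoor`). This gives the reduction from
Hitting Set, and for hardness it leaves only the task of producing a hitting set instance.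

Membership in W[2]: being consistent and meeting every clause is a `Π₂` property of a set of
literals. Dummy elements of the universe turn "at most `k`" into "exactly `k`"
(`exists_hitting_iff_weightedDef`).

Hardness: list all tuples that may belong to the relation `S`, behind a sentinel. A set of `k`
tuples corresponds to a chain of `k + 1` nonempty suffixes that starts with the whole list and whose
later members begin with the successive elements of `S`. Two consecutive suffixes form a gap, and a
gap decides locally whether a tuple in it lies in `S`: it does exactly if it is the head. Thus
negative atoms are witnessed by a bounded amount of data, like positive ones. If `m` atoms contain
the relation variable, the matrix holds for some choice of the existential variables if and only if
some `m` slots carry gaps that locate all these atoms and make the matrix true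
(`holds_iff_exists_gapEval`). This is one clause for each tuple of universal values. The budget `(k
+ 1) + (k + 1) ^ m` forces exactly one choice for each slot and for each `m`-tuple of slots, and
further positive clauses make these choices agree (`selectionClauses_iff`, `mem_weightedDef_iff`).

Bounded clauses: a literal of an unmet clause has to be chosen, in at most `d` ways, and at most `k`
times. Depth first search visits at most `(k + 1) * d ^ k` nodes, and its stack stays polynomially
small, so each step is polynomial (`runs_search`, `weakEBackdoorDCNF_solvable`).

Running times are handled through `PolyTime`, whose closure properties are registered for
`fun_prop`. Iteration enters through folds over lists with polynomially bounded accumulators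
(`PolyTime.foldl_of_bdd`); the only other loop is the search itself. -/

theorem Val.one_le_size (x : Val) : 1 ≤ x.size := by
  cases x <;> simp [Val.size]

theorem Val.size_hd_le (x : Val) : x.hd.size ≤ x.size := by
  cases x <;> simp [Val.size, Val.hd]; omega

theorem Val.size_tl_le (x : Val) : x.tl.size ≤ x.size := by
  cases x <;> simp [Val.size, Val.tl]; omega

/-- Every elementary operation pays for the size of its argument. Consequently a time bound is also
a bound on the output, which is what makes polynomial time closed under composition. -/
theorem Runs.size_le {p : Prog} {x y : Val} {t : ℕ} (h : Runs p x y t) :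
    x.size ≤ t ∧ y.size ≤ t := by
  induction h with
  | nil x => simp [Val.size]
  | skip x => simp
  | hd x => have := x.size_hd_le; omega
  | tl x => have := x.size_tl_le; omega
  | eq x =>
    have := x.one_le_size
    split_ifs <;> simp [Val.size]
    omega
  | pair _ _ h1 h2 => simp only [Val.size]; omega
  | _ => omega

/-- An injective encoding of the elements of a type by data values. -/
class Enc (α : Type) where
  enc : α → Val
  enc_injective : Function.Injective enc

open Enc

instance : Enc Val := ⟨id, fun _ _ h => h⟩

instance : Enc Unit := ⟨fun _ => Val.nil, fun _ _ _ => rfl⟩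

instance : Enc Bool where
  enc b := if b then Val.cons Val.nil Val.nil else Val.nil
  enc_injective := by intro a b h; cases a <;> cases b <;> simp_all

theorem Val.ofNat_injective : Function.Injective Val.ofNat := by
  intro a
  induction a with
  | zero => intro b h; cases b <;> simp_all [Val.ofNat]
  | succ a ih =>
    intro b h
    cases b with
    | zero => simp [Val.ofNat] at h
    | succ b => rw [ih (Val.cons.inj h).2]

instance : Enc ℕ := ⟨Val.ofNat, Val.ofNat_injective⟩

instance {α β : Type} [Enc α] [Enc β] : Enc (α × β) where
  enc a := Val.cons (enc a.1) (enc a.2)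
  enc_injective := by
    rintro ⟨a, b⟩ ⟨c, d⟩ h
    simp only [Val.cons.injEq] at h
    rw [enc_injective h.1, enc_injective h.2]

theorem Val.ofList_injective : Function.Injective Val.ofList := by
  intro a b h
  rw [← Val.toList_ofList a, h, Val.toList_ofList]

instance {α : Type} [Enc α] : Enc (List α) where
  enc l := Val.ofList (l.map enc)
  enc_injective := Val.ofList_injective.comp (List.map_injective_iff.2 enc_injective)

variable {α β γ : Type} [Enc α] [Enc β] [Enc γ]

@[simp] theorem enc_unit (x : Unit) : enc x = Val.nil := rfl
@[simp] theorem enc_true : enc true = Val.cons Val.nil Val.nil := rfl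
@[simp] theorem enc_false : enc false = Val.nil := rfl
@[simp] theorem enc_succ (n : ℕ) : enc (n + 1) = Val.cons Val.nil (enc n) := rfl
@[simp] theorem enc_mk (a : α) (b : β) : enc (a, b) = Val.cons (enc a) (enc b) := rfl
@[simp] theorem enc_nil : enc ([] : List α) = Val.nil := rfl
@[simp] theorem enc_cons (a : α) (l : List α) : enc (a :: l) = Val.cons (enc a) (enc l) := rfl

/-- The size of the encoding. -/
def esize (a : α) : ℕ := (enc a).size

theorem one_le_esize (a : α) : 1 ≤ esize a := Val.one_le_size _

@[simp] theorem esize_mk (a : α) (b : β) : esize (a, b) = esize a + esize b + 1 := rfl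
@[simp] theorem esize_nil : esize ([] : List α) = 1 := rfl
@[simp] theorem esize_cons (a : α) (l : List α) : esize (a :: l) = esize a + esize l + 1 := rfl

theorem esize_le_of_mem {a : α} {l : List α} (h : a ∈ l) : esize a ≤ esize l := by
  induction l with
  | nil => simp at h
  | cons b l ih =>
    rcases List.mem_cons.1 h with rfl | h
    · simp; omega
    · have := ih h; simp; omega

theorem length_le_esize (l : List α) : l.length ≤ esize l := by
  induction l with
  | nil => simp
  | cons b l ih => simp; omega

theorem esize_append (l l' : List α) : esize (l ++ l') + 1 = esize l + esize l' := by
  induction l with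
  | nil => simp; omega
  | cons b l ih => simp; omega

theorem esize_le_of_length_le {l : List α} {n m : ℕ} (h1 : l.length ≤ n)
    (h2 : ∀ a ∈ l, esize a ≤ m) : esize l ≤ n * (m + 1) + 1 := by
  have h : esize l ≤ l.length * (m + 1) + 1 := by
    clear h1
    induction l with
    | nil => simp
    | cons b l ih =>
      have h3 := ih fun a ha => h2 a (List.mem_cons_of_mem _ ha)
      have h4 := h2 b List.mem_cons_self
      simp only [esize_cons, List.length_cons, Nat.add_mul]
      omega
  exact h.trans (by gcongr)

theorem esize_suffix_le {l l' : List α} (h : l <:+ l') : esize l ≤ esize l' := by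
  obtain ⟨t, rfl⟩ := h
  have := esize_append t l
  have := one_le_esize t
  omega

/-! ### Polynomial bounds and basic polynomial time functions -/

/-- Quantities that are bounded by a polynomial in the size of the encoding. -/
def PolyBdd (g : α → ℕ) : Prop := ∃ c, ∀ a, g a ≤ (esize a + 2) ^ c

namespace PolyBdd

theorem mono {g h : α → ℕ} (hh : PolyBdd h) (hgh : ∀ a, g a ≤ h a) : PolyBdd g := by
  obtain ⟨c, hc⟩ := hh
  exact ⟨c, fun a => (hgh a).trans (hc a)⟩

theorem const (n : ℕ) : PolyBdd (fun _ : α => n) :=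
  ⟨n, fun a => Nat.lt_two_pow_self.le.trans (Nat.pow_le_pow_left (by omega) n)⟩

theorem size : PolyBdd (fun a : α => esize a) := ⟨1, fun a => by simp⟩

theorem mul {g h : α → ℕ} (hg : PolyBdd g) (hh : PolyBdd h) : PolyBdd (fun a => g a * h a) := by
  obtain ⟨c, hc⟩ := hg
  obtain ⟨d, hd⟩ := hh
  exact ⟨c + d, fun a => by rw [pow_add]; exact Nat.mul_le_mul (hc a) (hd a)⟩

/-- The base `esize a + 2` is at least 2, so one more factor absorbs the sum of two equal powers. -/
theorem add {g h : α → ℕ} (hg : PolyBdd g) (hh : PolyBdd h) : PolyBdd (fun a => g a + h a) := by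
  obtain ⟨c, hc⟩ := hg
  obtain ⟨d, hd⟩ := hh
  refine ⟨max c d + 1, fun a => ?_⟩
  have h1 : (esize a + 2) ^ c ≤ (esize a + 2) ^ max c d :=
    Nat.pow_le_pow_right (by omega) (le_max_left _ _)
  have h2 : (esize a + 2) ^ d ≤ (esize a + 2) ^ max c d :=
    Nat.pow_le_pow_right (by omega) (le_max_right _ _)
  calc g a + h a ≤ (esize a + 2) ^ max c d * 2 := by have := hc a; have := hd a; omega
    _ ≤ _ := by rw [pow_succ]; gcongr; omega

theorem pow {g : α → ℕ} (hg : PolyBdd g) (n : ℕ) : PolyBdd (fun a => g a ^ n) := by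
  induction n with
  | zero => simpa using const 1
  | succ n ih => simpa only [pow_succ] using ih.mul hg

theorem comp {h : β → ℕ} (hh : PolyBdd h) {f : α → β} (hf : PolyBdd fun a => esize (f a)) :
    PolyBdd fun a => h (f a) := by
  obtain ⟨c, hc⟩ := hh
  exact ((hf.add (const 2)).pow c).mono fun a => hc (f a)

end PolyBdd

/-- Functions that are computed in polynomial time. -/
@[fun_prop]
def PolyTime (f : α → β) : Prop :=
  ∃ (p : Prog) (g : α → ℕ), PolyBdd g ∧ ∀ a, ∃ t, Runs p (enc a) (enc (f a)) t ∧ t ≤ g a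

namespace PolyTime

theorem esize_bdd {f : α → β} (hf : PolyTime f) : PolyBdd fun a => esize (f a) := by
  obtain ⟨p, g, hg, h⟩ := hf
  refine hg.mono fun a => ?_
  obtain ⟨t, ht, htg⟩ := h a
  exact ht.size_le.2.trans htg

theorem of_prog {f : α → β} (p : Prog) (h : ∀ a, Runs p (enc a) (enc (f a)) (esize a + 2)) :
    PolyTime f :=
  ⟨p, _, PolyBdd.size.add (PolyBdd.const 2), fun a => ⟨_, h a, le_rfl⟩⟩

/-- Functions that do not change the encoding. -/
theorem of_enc_eq {f : α → β} (h : ∀ a, enc (f a) = enc a) : PolyTime f :=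
  of_prog Prog.skip fun a => by rw [h]; exact Runs.skip _

@[fun_prop] theorem id : PolyTime (fun a : α => a) := of_enc_eq fun _ => rfl

@[fun_prop] theorem comp {f : β → γ} {g : α → β} (hf : PolyTime f) (hg : PolyTime g) :
    PolyTime fun a => f (g a) := by
  have hs := hg.esize_bdd
  obtain ⟨p, h, hh, hp⟩ := hf
  obtain ⟨q, k, hk, hq⟩ := hg
  refine ⟨Prog.seq q p, _, (hk.add (hh.comp hs)).add (PolyBdd.const 1), fun a => ?_⟩
  obtain ⟨t, ht, htg⟩ := hq a
  obtain ⟨s, hs, hsg⟩ := hp (g a)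
  exact ⟨_, Runs.seq ht hs, by omega⟩

@[fun_prop] theorem prodMk {f : α → β} {g : α → γ} (hf : PolyTime f) (hg : PolyTime g) :
    PolyTime fun a => (f a, g a) := by
  obtain ⟨p, h, hh, hp⟩ := hf
  obtain ⟨q, k, hk, hq⟩ := hg
  refine ⟨Prog.pair p q, _, (hh.add hk).add (PolyBdd.const 1), fun a => ?_⟩
  obtain ⟨t, ht, htg⟩ := hp a
  obtain ⟨s, hs, hsg⟩ := hq a
  exact ⟨_, Runs.pair ht hs, by omega⟩

theorem nil_const : PolyTime fun _ : α => Val.nil := of_prog Prog.nil fun _ => Runs.nil _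

theorem val_hd' : PolyTime Val.hd := of_prog Prog.hd fun _ => Runs.hd _
theorem val_tl' : PolyTime Val.tl := of_prog Prog.tl fun _ => Runs.tl _

/-- Transport along equality of encodings. -/
theorem of_enc_comp {f : α → β} {g : α → γ} (hg : PolyTime g) (h : ∀ a, enc (f a) = enc (g a)) :
    PolyTime f := by
  obtain ⟨q, k, hk, hq⟩ := hg
  exact ⟨q, k, hk, fun a => by rw [h]; exact hq a⟩

theorem enc_comp {f : α → β} (hf : PolyTime f) : PolyTime fun a => enc (f a) :=
  of_enc_comp hf fun _ => rfl

@[fun_prop] theorem val_cons {f g : α → Val} (hf : PolyTime f) (hg : PolyTime g) :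
    PolyTime fun a => Val.cons (f a) (g a) :=
  of_enc_comp (prodMk hf hg) fun _ => rfl

@[fun_prop] theorem const (b : β) : PolyTime fun _ : α => b := by
  suffices h : ∀ v : Val, PolyTime fun _ : α => v from of_enc_comp (h (enc b)) fun _ => rfl
  intro v
  induction v with
  | nil => exact nil_const
  | cons a b ha hb => exact val_cons ha hb

@[fun_prop] theorem val_hd {f : α → Val} (hf : PolyTime f) : PolyTime fun a => (f a).hd :=
  val_hd'.comp hf

@[fun_prop] theorem val_tl {f : α → Val} (hf : PolyTime f) : PolyTime fun a => (f a).tl :=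
  val_tl'.comp hf

@[fun_prop] theorem fst {f : α → β × γ} (hf : PolyTime f) : PolyTime fun a => (f a).1 :=
  of_enc_comp (val_hd hf.enc_comp) fun _ => rfl

@[fun_prop] theorem snd {f : α → β × γ} (hf : PolyTime f) : PolyTime fun a => (f a).2 :=
  of_enc_comp (val_tl hf.enc_comp) fun _ => rfl

@[fun_prop] theorem decide_eq [DecidableEq β] {f g : α → β} (hf : PolyTime f) (hg : PolyTime g) :
    PolyTime fun a => decide (f a = g a) := by
  have h : PolyTime fun z : β × β => decide (z.1 = z.2) := by
    refine of_prog Prog.eq fun z => ?_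
    have h1 := Runs.eq (enc z)
    have h2 : ((enc z).hd = (enc z).tl) ↔ z.1 = z.2 := enc_injective.eq_iff
    by_cases h3 : z.1 = z.2
    · simpa [h2, h3, esize] using h1
    · simpa [h2, h3, esize] using h1
  exact h.comp (hf.prodMk hg)

@[fun_prop] theorem ite {c : α → Bool} {f g : α → β} (hc : PolyTime c) (hf : PolyTime f)
    (hg : PolyTime g) : PolyTime fun a => if c a = true then f a else g a := by
  obtain ⟨r, j, hj, hr⟩ := hc
  obtain ⟨p, h, hh, hp⟩ := hf
  obtain ⟨q, k, hk, hq⟩ := hg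
  refine ⟨Prog.cond r p q, _, ((hj.add hh).add hk).add (PolyBdd.const 1), fun a => ?_⟩
  obtain ⟨u, hu, hug⟩ := hr a
  obtain ⟨t, ht, htg⟩ := hp a
  obtain ⟨s, hs, hsg⟩ := hq a
  cases hb : c a
  · rw [hb] at hu
    exact ⟨_, Runs.cond_false hu (by simpa [hb] using hs), by omega⟩
  · rw [hb] at hu
    exact ⟨_, Runs.cond_true hu (by simp) (by simpa [hb] using ht), by omega⟩

@[fun_prop] theorem not {c : α → Bool} (hc : PolyTime c) : PolyTime fun a => !(c a) := by
  have h : (fun a => !(c a)) = fun a => if c a = true then false else true := by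
    funext a; cases c a <;> rfl
  rw [h]; fun_prop

@[fun_prop] theorem and {c d : α → Bool} (hc : PolyTime c) (hd : PolyTime d) :
    PolyTime fun a => c a && d a := by
  have h : (fun a => c a && d a) = fun a => if c a = true then d a else false := by
    funext a; cases c a <;> rfl
  rw [h]; fun_prop

@[fun_prop] theorem or {c d : α → Bool} (hc : PolyTime c) (hd : PolyTime d) :
    PolyTime fun a => c a || d a := by
  have h : (fun a => c a || d a) = fun a => if c a = true then true else d a := by
    funext a; cases c a <;> rfl
  rw [h]; fun_prop

@[fun_prop] theorem cons {f : α → β} {g : α → List β} (hf : PolyTime f) (hg : PolyTime g) :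
    PolyTime fun a => f a :: g a :=
  of_enc_comp (prodMk hf hg) fun _ => rfl

-- A number in unary has the same encoding as a list of that many units, so the successor is an
-- instance of `cons`.
@[fun_prop] theorem succ {f : α → ℕ} (hf : PolyTime f) : PolyTime fun a => f a + 1 :=
  of_enc_comp (cons (const ()) (of_enc_comp (f := fun a => List.replicate (f a) ()) hf fun a => by
    induction f a with
    | zero => rfl
    | succ n ih => simp [List.replicate_succ, ih])) fun a => by
    simp only [enc_cons, enc_succ]
    congr 1
    induction f a with
    | zero => rfl
    | succ n ih => simp [List.replicate_succ, ih]

@[fun_prop] theorem tail {f : α → List β} (hf : PolyTime f) : PolyTime fun a => (f a).tail :=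
  of_enc_comp (val_tl hf.enc_comp) fun a => by cases f a <;> rfl

@[fun_prop] theorem pred {f : α → ℕ} (hf : PolyTime f) : PolyTime fun a => f a - 1 :=
  of_enc_comp (val_tl hf.enc_comp) fun a => by cases f a <;> rfl

@[fun_prop] theorem isEmpty {f : α → List β} (hf : PolyTime f) :
    PolyTime fun a => (f a).isEmpty := by
  have h : (fun a => (f a).isEmpty) = fun a => decide (enc (f a) = Val.nil) := by
    funext a; cases f a <;> simp
  rw [h]
  exact decide_eq hf.enc_comp (const _)

@[fun_prop] theorem headD {f : α → List β} {g : α → β} (hf : PolyTime f) (hg : PolyTime g) :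
    PolyTime fun a => (f a).headD (g a) := by
  have h : PolyTime fun a => if (f a).isEmpty = true then enc (g a) else (enc (f a)).hd :=
    ite hf.isEmpty hg.enc_comp (val_hd hf.enc_comp)
  exact of_enc_comp h fun a => by cases f a <;> rfl

end PolyTime

/-! ### Loops and folds -/

theorem Runs.loop_iterate {c p : Prog} {K : ℕ} (s : ℕ → Val) (n : ℕ)
    (hstep : ∀ i < n, ∃ b t u, Runs c (s i) b t ∧ b ≠ Val.nil ∧ Runs p (s i) (s (i + 1)) u ∧
      t + u ≤ K)
    (hlast : ∃ t, Runs c (s n) Val.nil t ∧ t ≤ K) :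
    ∃ t, Runs (Prog.loop c p) (s 0) (s n) t ∧ t ≤ (n + 1) * (K + 1) := by
  induction n generalizing s with
  | zero =>
    obtain ⟨t, ht, htK⟩ := hlast
    exact ⟨_, Runs.loop_stop ht, by omega⟩
  | succ n ih =>
    obtain ⟨v, hv, hvK⟩ := ih (fun i => s (i + 1)) (fun i hi => hstep (i + 1) (by omega)) hlast
    obtain ⟨b, t, u, ht, hb, hu, hK⟩ := hstep 0 (by omega)
    refine ⟨_, Runs.loop_step ht hb hu hv, ?_⟩
    rw [Nat.add_mul]
    omega

namespace PolyTime

/-- Folds with polynomially bounded intermediate results. -/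
theorem foldl_of_bdd {f : α → γ → β → γ} {init : α → γ} {l : α → List β}
    (hf : PolyTime fun z : α × γ × β => f z.1 z.2.1 z.2.2) (hi : PolyTime init) (hl : PolyTime l)
    (h : α → ℕ) (hh : PolyBdd h)
    (hs : ∀ a n, esize (((l a).take n).foldl (f a) (init a)) ≤ h a) :
    PolyTime fun a => (l a).foldl (f a) (init a) := by
  have hls := hl.esize_bdd
  obtain ⟨q, k, hk, hq⟩ := id.prodMk (hl.prodMk hi)
  obtain ⟨p, g, ⟨e, he⟩, hp⟩ := hf
  -- The loop state is the triple of the input `a`, the remaining list and the accumulator. The test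
  -- `c` returns the remaining list, which is encoded by `nil` exactly when it is empty. The body
  -- keeps `a`, drops the first entry, and runs `p` on `a`, the accumulator and that entry.
  set c : Prog := Prog.seq Prog.tl Prog.hd
  set b : Prog := Prog.pair Prog.hd (Prog.pair (Prog.seq Prog.tl (Prog.seq Prog.hd Prog.tl))
    (Prog.seq (Prog.pair Prog.hd (Prog.pair (Prog.seq Prog.tl Prog.tl)
      (Prog.seq Prog.tl (Prog.seq Prog.hd Prog.hd)))) p))
  -- a bound on the sizes of the states
  set M : α → ℕ := fun a => esize a + esize (l a) + h a + 2
  have hM : PolyBdd M := ((PolyBdd.size.add hls).add hh).add (PolyBdd.const 2)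
  -- The power pays for `p`; the other terms pay for the fixed number of elementary operations in
  -- the test and the body.
  set K : α → ℕ := fun a => 20 * (M a + 2) + (M a + 2) ^ e + 20
  have hK : PolyBdd K :=
    (((PolyBdd.const 20).mul (hM.add (PolyBdd.const 2))).add
      ((hM.add (PolyBdd.const 2)).pow e)).add (PolyBdd.const 20)
  refine ⟨Prog.seq q (Prog.seq (Prog.loop c b) (Prog.seq Prog.tl Prog.tl)), _,
    (hk.add ((hls.add (PolyBdd.const 1)).mul (hK.add (PolyBdd.const 1)))).add
      (((PolyBdd.const 2).mul hM).add (PolyBdd.const 20)), fun a => ?_⟩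
  obtain ⟨t, ht, htk⟩ := hq a
  set s : ℕ → Val := fun n =>
    enc (a, (l a).drop n, ((l a).take n).foldl (f a) (init a)) with hsdef
  have hsize : ∀ n, (enc ((l a).drop n)).size ≤ esize (l a) := fun n =>
    esize_suffix_le (List.drop_suffix n (l a))
  have hend : s (l a).length = Val.cons (enc a) (Val.cons Val.nil
      (enc ((l a).foldl (f a) (init a)))) := by
    simp [hsdef]
  have hloop := Runs.loop_iterate (c := c) (p := b) (K := K a) s (l a).length
    (by
      intro i hi
      have h1 : (l a).drop i = (l a)[i] :: (l a).drop (i + 1) := List.drop_eq_getElem_cons hi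
      have h2 : (l a).take (i + 1) = (l a).take i ++ [(l a)[i]] := by simp
      have h3 := hs a i
      obtain ⟨u, hu, hug⟩ := hp (a, ((l a).take i).foldl (f a) (init a), (l a)[i])
      have h4 := he (a, ((l a).take i).foldl (f a) (init a), (l a)[i])
      have h5 := hsize i
      have h6 := hsize (i + 1)
      set S := ((l a).take i).foldl (f a) (init a) with hS
      have h7 : s i = Val.cons (enc a) (Val.cons (Val.cons (enc (l a)[i])
          (enc ((l a).drop (i + 1)))) (enc S)) := by
        simp only [hsdef, h1, ← hS, enc_mk, enc_cons]
      have h8 : s (i + 1) = Val.cons (enc a) (Val.cons (enc ((l a).drop (i + 1)))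
          (enc (f a S (l a)[i]))) := by
        simp only [hsdef, h2, List.foldl_append, ← hS, enc_mk, List.foldl_cons, List.foldl_nil]
      rw [h7, h8]
      refine ⟨_, _, _, Runs.seq (Runs.tl _) (Runs.hd _), ?_, Runs.pair (Runs.hd _)
        (Runs.pair (Runs.seq (Runs.tl _) (Runs.seq (Runs.hd _) (Runs.tl _)))
          (Runs.seq (Runs.pair (Runs.hd _) (Runs.pair (Runs.seq (Runs.tl _) (Runs.tl _))
            (Runs.seq (Runs.tl _) (Runs.seq (Runs.hd _) (Runs.hd _))))) hu)), ?_⟩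
      · simp [Val.hd, Val.tl]
      · have h9 : (enc ((l a).drop i)).size = (enc (l a)[i]).size +
            (enc ((l a).drop (i + 1))).size + 1 := by rw [h1]; rfl
        have h10 : (esize (a, S, (l a)[i]) + 2) ^ e ≤ (M a + 2) ^ e := by
          apply Nat.pow_le_pow_left
          simp only [esize_mk, M]
          have : esize (l a)[i] ≤ esize (l a) := esize_le_of_mem (List.getElem_mem hi)
          omega
        simp only [Val.hd, Val.tl, Val.size, K]
        simp only [esize, M] at *
        omega)
    (by
      rw [hend]
      refine ⟨_, Runs.seq (Runs.tl _) (Runs.hd _), ?_⟩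
      have := hs a (l a).length
      rw [List.take_length] at this
      simp only [Val.tl, Val.size, K]
      simp only [esize, M] at *
      omega)
  obtain ⟨u, hu, huK⟩ := hloop
  have hz : (s (l a).length).tl.tl = enc ((l a).foldl (f a) (init a)) := by rw [hend]; rfl
  have hv := Runs.seq (Runs.tl (s (l a).length)) (Runs.tl (s (l a).length).tl)
  rw [hz] at hv
  refine ⟨_, Runs.seq ht (Runs.seq hu hv), ?_⟩
  · have h1 := hs a (l a).length
    rw [List.take_length] at h1
    have h2 : (l a).length + 1 ≤ esize (l a) + 1 := by have := length_le_esize (l a); omega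
    have h3 := huK.trans (Nat.mul_le_mul_right (K a + 1) h2)
    rw [hend]
    simp only [Val.tl, Val.size]
    simp only [esize, M] at *
    omega

/-- Folds in which every step increases the size by a bounded amount. -/
theorem foldl {f : α → γ → β → γ} {init : α → γ} {l : α → List β}
    (hf : PolyTime fun z : α × γ × β => f z.1 z.2.1 z.2.2) (hi : PolyTime init) (hl : PolyTime l)
    (I : α → γ → Prop) (h : α → ℕ) (hh : PolyBdd h) (hI : ∀ a, I a (init a))
    (hs : ∀ a, ∀ b ∈ l a, ∀ s, I a s → I a (f a s b) ∧ esize (f a s b) ≤ esize s + h a) :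
    PolyTime fun a => (l a).foldl (f a) (init a) := by
  refine foldl_of_bdd hf hi hl (fun a => esize (init a) + esize (l a) * h a)
    (hi.esize_bdd.add (hl.esize_bdd.mul hh)) fun a n => ?_
  have key : ∀ l' : List β, (∀ b ∈ l', b ∈ l a) → ∀ s, I a s →
      esize (l'.foldl (f a) s) ≤ esize s + l'.length * h a := by
    intro l'
    induction l' with
    | nil => simp
    | cons b l' ih =>
      intro hl' s hIs
      obtain ⟨h1, h2⟩ := hs a b (hl' b List.mem_cons_self) s hIs
      have h3 := ih (fun b hb => hl' b (List.mem_cons_of_mem _ hb)) _ h1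
      simp only [List.foldl_cons, List.length_cons, Nat.add_mul]
      omega
  have h4 := key ((l a).take n) (fun b hb => List.mem_of_mem_take hb) _ (hI a)
  have h5 : ((l a).take n).length ≤ esize (l a) :=
    (List.length_take_le' _ _).trans (length_le_esize _)
  exact h4.trans (Nat.add_le_add_left (Nat.mul_le_mul_right _ h5) _)

/-! ### List operations in polynomial time -/

@[fun_prop] theorem reverse {l : α → List β} (hl : PolyTime l) :
    PolyTime fun a => (l a).reverse := by
  have h : PolyTime fun a => (l a).foldl (fun s b => b :: s) [] := by
    refine foldl (f := fun _ s b => b :: s) (by fun_prop) (const _) hl (fun _ _ => True)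
      (fun a => esize (l a) + 1) (hl.esize_bdd.add (PolyBdd.const 1)) (fun _ => trivial) ?_
    intro a b hb s _
    have := esize_le_of_mem hb
    simp only [esize_cons, true_and]
    omega
  simpa using h

@[fun_prop] theorem append {l l' : α → List β} (hl : PolyTime l) (hl' : PolyTime l') :
    PolyTime fun a => l a ++ l' a := by
  have h : PolyTime fun a => (l a).reverse.foldl (fun s b => b :: s) (l' a) := by
    refine foldl (f := fun _ s b => b :: s) (by fun_prop) hl' hl.reverse (fun _ _ => True)
      (fun a => esize (l a) + 1) (hl.esize_bdd.add (PolyBdd.const 1)) (fun _ => trivial) ?_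
    intro a b hb s _
    have := esize_le_of_mem (List.mem_reverse.1 hb)
    simp only [esize_cons, true_and]
    omega
  simpa using h

@[fun_prop] theorem flatten {l : α → List (List β)} (hl : PolyTime l) :
    PolyTime fun a => (l a).flatten := by
  have h : PolyTime fun a => (l a).foldl (fun s b => s ++ b) [] := by
    refine foldl (f := fun _ s b => s ++ b) (by fun_prop) (const _) hl (fun _ _ => True)
      (fun a => esize (l a)) hl.esize_bdd (fun _ => trivial) ?_
    intro a b hb s _
    have := esize_le_of_mem hb
    have := esize_append s b
    simp only [true_and]
    omega
  have h2 : ∀ (m : List (List β)) (s : List β), m.foldl (fun s b => s ++ b) s = s ++ m.flatten := by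
    intro m
    induction m with
    | nil => simp
    | cons b m ih => intro s; simp [ih]
  simpa [h2] using h

@[fun_prop] theorem map {f : α → β → γ} {l : α → List β}
    (hf : PolyTime fun z : α × β => f z.1 z.2) (hl : PolyTime l) :
    PolyTime fun a => (l a).map (f a) := by
  obtain ⟨c, hc⟩ := hf.esize_bdd
  have h : PolyTime fun a => ((l a).foldl (fun s b => f a b :: s) []).reverse := by
    refine reverse (foldl (f := fun a s b => f a b :: s) ?_ (const _) hl (fun _ _ => True)
      (fun a => (esize a + esize (l a) + 1 + 2) ^ c + 1)
      (((((PolyBdd.size.add hl.esize_bdd).add (PolyBdd.const 1)).add (PolyBdd.const 2)).pow c).add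
        (PolyBdd.const 1)) (fun _ => trivial) ?_)
    · exact cons (hf.comp (g := fun z : α × List γ × β => (z.1, z.2.2)) (by fun_prop)) (by fun_prop)
    intro a b hb s _
    have h1 := esize_le_of_mem hb
    have h2 := hc (a, b)
    have h3 : (esize (a, b) + 2) ^ c ≤ (esize a + esize (l a) + 1 + 2) ^ c := by
      apply Nat.pow_le_pow_left
      simp only [esize_mk]
      omega
    simp only [esize_cons, true_and]
    simp only at h2
    omega
  have h2 : ∀ a (m : List β) (s : List γ), m.foldl (fun s b => f a b :: s) s =
      (m.map (f a)).reverse ++ s := by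
    intro a m
    induction m with
    | nil => simp
    | cons b m ih => intro s; simp [ih]
  simpa [h2] using h

@[fun_prop] theorem flatMap {f : α → β → List γ} {l : α → List β}
    (hf : PolyTime fun z : α × β => f z.1 z.2) (hl : PolyTime l) :
    PolyTime fun a => (l a).flatMap (f a) := by
  have h : PolyTime fun a => ((l a).map (f a)).flatten := flatten (map hf hl)
  simpa [List.flatMap_def] using h

@[fun_prop] theorem filter {f : α → β → Bool} {l : α → List β}
    (hf : PolyTime fun z : α × β => f z.1 z.2) (hl : PolyTime l) :
    PolyTime fun a => (l a).filter (f a) := by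
  have h : PolyTime fun a => (l a).flatMap fun b => if f a b = true then [b] else [] := by
    refine flatMap (f := fun a b => if f a b = true then [b] else []) (ite hf ?_ ?_) hl <;> fun_prop
  have h2 : ∀ a (m : List β), (m.flatMap fun b => if f a b = true then [b] else []) =
      m.filter (f a) := by
    intro a m
    induction m with
    | nil => simp
    | cons b m ih => by_cases hb : f a b = true <;> simp [hb, ih]
  simpa [h2] using h

@[fun_prop] theorem any {f : α → β → Bool} {l : α → List β}
    (hf : PolyTime fun z : α × β => f z.1 z.2) (hl : PolyTime l) :
    PolyTime fun a => (l a).any (f a) := by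
  have h : PolyTime fun a => !((l a).filter (f a)).isEmpty := not (isEmpty (filter hf hl))
  convert h using 2 with a
  rw [Bool.eq_iff_iff]
  simp

@[fun_prop] theorem all {f : α → β → Bool} {l : α → List β}
    (hf : PolyTime fun z : α × β => f z.1 z.2) (hl : PolyTime l) :
    PolyTime fun a => (l a).all (f a) := by
  have h : PolyTime fun a => !((l a).any fun b => !(f a b)) := not (any hf.not hl)
  convert h using 2 with a
  rw [Bool.eq_iff_iff]
  simp

@[fun_prop] theorem decide_mem {f : α → β} {l : α → List β} [∀ a, Decidable (f a ∈ l a)]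
    (hf : PolyTime f) (hl : PolyTime l) : PolyTime fun a => decide (f a ∈ l a) := by
  classical
  have h : PolyTime fun a => (l a).any fun b => decide (b = f a) := by fun_prop
  convert h using 2 with a
  rw [Bool.eq_iff_iff]
  simp

theorem enc_replicate_unit (n : ℕ) : enc (List.replicate n ()) = enc n := by
  induction n with
  | zero => rfl
  | succ n ih => simp [List.replicate_succ, ih]

@[fun_prop] theorem replicate_unit {f : α → ℕ} (hf : PolyTime f) :
    PolyTime fun a => List.replicate (f a) () :=
  of_enc_comp hf fun _ => enc_replicate_unit _

@[fun_prop] theorem length {l : α → List β} (hl : PolyTime l) : PolyTime fun a => (l a).length := by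
  have h : PolyTime fun a => (l a).map fun _ => () := by fun_prop
  refine of_enc_comp h fun a => ?_
  rw [← enc_replicate_unit]
  simp

@[fun_prop] theorem tails {l : α → List β} (hl : PolyTime l) : PolyTime fun a => (l a).tails := by
  -- Reading from the right, the head of the accumulator is the longest suffix found so far.
  have h2 : ∀ m : List β, m.reverse.foldl (fun s b => (b :: s.headD []) :: s) [[]] = m.tails := by
    intro m
    induction m with
    | nil => rfl
    | cons b m ih =>
      rw [List.reverse_cons, List.foldl_append, ih]
      cases m <;> simp
  have h : PolyTime fun a => (l a).reverse.foldl (fun s b => (b :: s.headD []) :: s) [[]] := by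
    refine foldl_of_bdd (f := fun _ s b => (b :: s.headD []) :: s) (by fun_prop) (const _)
      hl.reverse (fun a => (esize (l a) + 1) * (esize (l a) + 1) + 1)
      (((hl.esize_bdd.add (PolyBdd.const 1)).mul (hl.esize_bdd.add (PolyBdd.const 1))).add
        (PolyBdd.const 1)) fun a n => ?_
    -- Each intermediate accumulator is itself the list of tails of a suffix, hence of at most
    -- quadratic size.
    rw [List.take_reverse, h2]
    have h3 := List.drop_suffix ((l a).length - n) (l a)
    refine esize_le_of_length_le ?_ fun m hm =>
      esize_suffix_le (((List.mem_tails _ _).1 hm).trans h3)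
    rw [List.length_tails]
    have := h3.length_le
    have := length_le_esize (l a)
    omega
  simpa only [h2] using h

-- The suffixes of a list of `n` units have the lengths `n, …, 0`; dropping the first and reversing
-- gives the range.
@[fun_prop] theorem range {f : α → ℕ} (hf : PolyTime f) : PolyTime fun a => List.range (f a) := by
  have h : PolyTime fun a => ((List.replicate (f a) ()).tails.map List.length).tail.reverse := by
    fun_prop
  have h2 : ∀ n, (List.replicate n ()).tails.map List.length = (List.range (n + 1)).reverse := by
    intro n
    induction n with
    | zero => rfl
    | succ n ih =>
      rw [List.replicate_succ, List.tails, List.map_cons, ih, List.range_succ (n := n + 1)]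
      simp
  have h3 : ∀ n, (((List.replicate n ()).tails.map List.length).tail).reverse = List.range n := by
    intro n
    rw [h2, List.range_succ]
    simp
  simpa only [h3] using h

@[fun_prop] theorem dedup [DecidableEq β] {l : α → List β} (hl : PolyTime l) :
    PolyTime fun a => (l a).dedup := by
  have h : PolyTime fun a => (l a).reverse.foldl
      (fun s b => if decide (b ∈ s) = true then s else b :: s) [] := by
    refine foldl (f := fun _ s b => if decide (b ∈ s) = true then s else b :: s) (by fun_prop)
      (const _) hl.reverse (fun _ _ => True)
      (fun a => esize (l a) + 1) (hl.esize_bdd.add (PolyBdd.const 1)) (fun _ => trivial) ?_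
    intro a b hb s _
    have := esize_le_of_mem (List.mem_reverse.1 hb)
    split_ifs <;> simp only [esize_cons, true_and] <;> omega
  have h2 : ∀ m : List β, m.reverse.foldl
      (fun s b => if decide (b ∈ s) = true then s else b :: s) [] = m.dedup := by
    intro m
    induction m with
    | nil => rfl
    | cons b m ih =>
      rw [List.reverse_cons, List.foldl_append, ih]
      by_cases hb : b ∈ m <;> simp [hb]
  simpa only [h2] using h

@[fun_prop] theorem val_toList {f : α → Val} (hf : PolyTime f) : PolyTime fun a => (f a).toList :=
  of_enc_comp hf fun a => by
    induction f a with
    | nil => rfl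
    | cons x y _ ih => simp only [Val.toList, enc_cons, ih]; rfl

theorem getD_const {l : α → List β} (hl : PolyTime l) (n : ℕ) (b : β) :
    PolyTime fun a => (l a).getD n b := by
  induction n generalizing l with
  | zero =>
    convert hl.headD (const b) using 2 with a
    cases l a <;> rfl
  | succ n ih =>
    have h := ih hl.tail
    convert h using 2 with a
    cases l a <;> simp

theorem ofFn {n : ℕ} {f : Fin n → α → β} (hf : ∀ i, PolyTime (f i)) :
    PolyTime fun a => List.ofFn fun i => f i a := by
  induction n with
  | zero => simpa using const []
  | succ n ih =>
    simp only [List.ofFn_succ]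
    exact cons (hf 0) (ih fun i => hf i.succ)

end PolyTime

/-! ### Enumeration of tuples -/

/-- All lists of length `n` with entries in `l`. -/
def tuples {α : Type} (l : List α) : ℕ → List (List α)
  | 0 => [[]]
  | n + 1 => l.flatMap fun a => (tuples l n).map fun t => a :: t

theorem mem_tuples {α : Type} {l : List α} {n : ℕ} {t : List α} :
    t ∈ tuples l n ↔ t.length = n ∧ ∀ a ∈ t, a ∈ l := by
  induction n generalizing t with
  | zero => simp only [tuples, List.mem_singleton, List.length_eq_zero_iff]; aesop
  | succ n ih =>
    cases t with
    | nil => simp [tuples]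
    | cons a t => simp [tuples, ih]; tauto

theorem length_tuples {α : Type} (l : List α) (n : ℕ) : (tuples l n).length = l.length ^ n := by
  induction n with
  | zero => rfl
  | succ n ih => simp [tuples, ih, List.length_flatMap, pow_succ, mul_comm]

theorem nodup_tuples {α : Type} {l : List α} (hl : l.Nodup) (n : ℕ) : (tuples l n).Nodup := by
  induction n with
  | zero => simp [tuples]
  | succ n ih =>
    refine List.nodup_flatMap.2 ⟨fun a _ => ih.map fun _ _ h => (List.cons.inj h).2, ?_⟩
    refine hl.imp_of_mem ?_
    rintro a b _ _ hab t h1 h2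
    simp only [List.mem_map] at h1 h2
    obtain ⟨_, _, rfl⟩ := h1
    obtain ⟨_, _, h⟩ := h2
    exact hab (List.cons.inj h).1.symm

@[fun_prop] theorem PolyTime.tuples {l : α → List β} (hl : PolyTime l) (n : ℕ) :
    PolyTime fun a => tuples (l a) n := by
  induction n with
  | zero => exact const _
  | succ n ih =>
    refine flatMap (f := fun a b => (ParamComplexity.tuples (l a) n).map fun t => b :: t)
      (map (f := fun z t => z.2 :: t) (by fun_prop) (ih.comp (fst id))) hl

/-! ### Computable bounds and composition of reductions -/

theorem primrec_pow_const (n : ℕ) : Primrec fun k : ℕ => k ^ n := by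
  induction n with
  | zero => simpa using Primrec.const 1
  | succ n ih => simpa only [pow_succ, id_eq] using Primrec.nat_mul.comp ih Primrec.id

theorem computable_add_two_pow {f : ℕ → ℕ} (hf : Computable f) (n : ℕ) :
    Computable fun k => (f k + 2) ^ n :=
  ((primrec_pow_const n).comp (Primrec.nat_add.comp Primrec.id (Primrec.const 2))).to_comp.comp hf

theorem computable_const_pow (d : ℕ) : Computable fun k : ℕ => d ^ k := by
  have h : Primrec fun k : ℕ => Nat.rec (motive := fun _ => ℕ) 1 (fun _ y => y * d) k :=
    Primrec.nat_rec₁ 1 ((Primrec.nat_mul.comp Primrec.snd (Primrec.const d)).to₂)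
  refine h.to_comp.of_eq fun k => ?_
  induction k with
  | zero => rfl
  | succ k ih => rw [pow_succ, ← ih]

theorem FPTReduces.refl (P : ParamProblem) : FPTReduces P P := by
  refine ⟨Prog.skip, fun _ => 3, fun k => k, 1, Computable.const 3, Computable.id, fun x k =>
    ⟨x, k, _, Runs.skip _, ?_, le_rfl, Iff.rfl⟩⟩
  have := (input x k).one_le_size
  simp only [pow_one]
  omega

/-- An fpt-reduction followed by a polynomial time reduction with a polynomial bound on the new
parameter. -/
theorem FPTReduces.trans_polyTime {P Q R : ParamProblem} (h : FPTReduces P Q)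
    {f : Val × ℕ → β × ℕ} (hf : PolyTime f) (e : ℕ) (he : ∀ x k, (f (x, k)).2 ≤ (k + 2) ^ e)
    (hR : ∀ x k, (x, k) ∈ Q ↔ (enc (f (x, k)).1, (f (x, k)).2) ∈ R) : FPTReduces P R := by
  obtain ⟨p, F, G, c, hF, hG, hp⟩ := h
  obtain ⟨q, g, ⟨d, hd⟩, hq⟩ := hf
  refine ⟨Prog.seq p q, fun k => (F k + 2) ^ (d + 2), fun k => (G k + 2) ^ e, c * (d + 2),
    computable_add_two_pow hF _, computable_add_two_pow hG _, fun x k => ?_⟩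
  obtain ⟨y, k', t, ht, htF, hk', hPQ⟩ := hp x k
  obtain ⟨u, hu, hug⟩ := hq (y, k')
  refine ⟨_, _, _, Runs.seq ht hu, ?_, (he y k').trans (Nat.pow_le_pow_left (by omega) _),
    hPQ.trans (hR y k')⟩
  -- The summand 2 gives `t + 2 ≤ X`. So `X` bounds the base of the polynomial for the second
  -- program, and, being at least 2, it absorbs a sum of two equal powers at the price of one more
  -- factor.
  set X := (F k + 2) * (input x k).size ^ c with hX
  have h1 : 1 ≤ (input x k).size ^ c := Nat.one_le_pow _ _ (input x k).one_le_size
  have h2 : t + 2 ≤ X := by rw [hX, Nat.add_mul]; omega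
  have h3 : esize (y, k') ≤ t := ht.size_le.2
  have h4 : u ≤ X ^ d := (hug.trans (hd _)).trans (Nat.pow_le_pow_left (by omega) _)
  calc t + u + 1 ≤ X + X ^ d := by omega
    _ ≤ X ^ (d + 1) + X ^ (d + 1) :=
      Nat.add_le_add (Nat.le_self_pow (by omega) X) (Nat.pow_le_pow_right (by omega) (by omega))
    _ = X ^ (d + 1) * 2 := by ring
    _ ≤ X ^ (d + 1) * X := Nat.mul_le_mul_left _ (by omega)
    _ = _ := by rw [← pow_succ, hX, mul_pow, ← pow_mul]

/-! ### Weak backdoors as sets of literals -/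

/-- A weak `E`-backdoor of size at most `k` is the same as a consistent set of at most `k` literals
that meets every clause. -/
theorem CNF.exists_isWeakBackdoor_iff {V : Type} [DecidableEq V] (F : CNF V) (k : ℕ) :
    (∃ B : Finset V, B.card ≤ k ∧ F.IsWeakBackdoor (CNF.emptyClass V) B) ↔
      ∃ S : Finset (Literal V), S.card ≤ k ∧ (∀ l ∈ S, (l.1, !l.2) ∉ S) ∧
        ∀ c ∈ F, ∃ l ∈ c, l ∈ S := by
  constructor
  · rintro ⟨B, hB, hBF, τ, -, h⟩
    refine ⟨B.image fun v => (v, τ v), Finset.card_image_le.trans hB, ?_, fun c hc => ?_⟩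
    · simp only [Finset.mem_image]
      rintro _ ⟨v, _, rfl⟩ ⟨w, _, hw⟩
      simp only [Prod.mk.injEq] at hw
      obtain ⟨rfl, hw⟩ := hw
      simp at hw
    · simp only [CNF.emptyClass, Set.mem_singleton_iff, CNF.simplify, Finset.image_eq_empty,
        Finset.filter_eq_empty_iff, not_not] at h
      obtain ⟨l, hl, hlB, hτ⟩ := h hc
      exact ⟨l, hl, Finset.mem_image.2 ⟨l.1, hlB, by rw [hτ]⟩⟩
  · rintro ⟨S, hS, hcons, hF⟩
    -- Variables of `S` outside `F` are useless and not allowed in a backdoor. The assignment makes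
    -- exactly the variables of positive literals in `S` true; a negative literal in `S` comes out
    -- true by consistency.
    have hempty : F.simplify (S.image Prod.fst ∩ F.vars) (fun v => decide ((v, true) ∈ S)) = ∅ := by
      simp only [CNF.simplify, Finset.image_eq_empty, Finset.filter_eq_empty_iff, not_not]
      intro c hc
      obtain ⟨⟨v, b⟩, hlc, hlS⟩ := hF c hc
      refine ⟨(v, b), hlc, Finset.mem_inter.2 ⟨Finset.mem_image_of_mem _ hlS, ?_⟩, ?_⟩
      · exact Finset.mem_biUnion.2 ⟨c, hc, Finset.mem_image_of_mem _ hlc⟩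
      · cases b
        · simpa using hcons _ hlS
        · simpa using hlS
    refine ⟨S.image Prod.fst ∩ F.vars, ?_, Finset.inter_subset_right, _, ?_, hempty⟩
    · exact (Finset.card_le_card Finset.inter_subset_left).trans (Finset.card_image_le.trans hS)
    · rw [hempty]
      exact ⟨fun _ => true, by simp⟩

theorem mem_weakEBackdoor {x : Val} {k : ℕ} : (x, k) ∈ weakEBackdoor ↔
    ∃ S : Finset (Literal Val), S.card ≤ k ∧ (∀ l ∈ S, (l.1, !l.2) ∉ S) ∧
      ∀ c ∈ x.toCNF, ∃ l ∈ c, l ∈ S :=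
  CNF.exists_isWeakBackdoor_iff _ _

theorem toList_enc (l : List α) : (enc l).toList = l.map enc := Val.toList_ofList _

/-- The formula with only positive literals that a family of clauses describes. -/
def positiveCNF {α : Type} (F : List (List α)) : List (List (Bool × α)) :=
  F.map fun c => c.map fun v => (true, v)

@[fun_prop] theorem PolyTime.positiveCNF {F : α → List (List β)} (hF : PolyTime F) :
    PolyTime fun a => positiveCNF (F a) := by
  unfold ParamComplexity.positiveCNF
  fun_prop

theorem mem_toCNF_positiveCNF {F : List (List α)} {c : Clause Val} :
    c ∈ (enc (positiveCNF F)).toCNF ↔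
      ∃ d ∈ F, c = (d.map fun v => ((enc v, true) : Literal Val)).toFinset := by
  simp only [Val.toCNF, toList_enc, positiveCNF, List.mem_toFinset, List.map_map, List.mem_map]
  refine exists_congr fun d => and_congr_right fun _ => ?_
  rw [eq_comm]
  simp only [Function.comp_apply, toList_enc, List.map_map]
  rfl

/-- Only positive literals on encoded elements can meet a clause, so a solution is pulled back along
the injection that sends an element to its positive literal. Conversely, a set of positive literals
is consistent automatically. -/
theorem positiveCNF_mem_weakEBackdoor {F : List (List α)} {k : ℕ} :
    (enc (positiveCNF F), k) ∈ weakEBackdoor ↔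
      ∃ H : Finset α, H.card ≤ k ∧ ∀ c ∈ F, ∃ v ∈ c, v ∈ H := by
  classical
  rw [mem_weakEBackdoor]
  constructor
  · rintro ⟨S, hS, -, h⟩
    have hinj : Set.InjOn (fun v : α => ((enc v, true) : Literal Val))
        ((fun v : α => ((enc v, true) : Literal Val)) ⁻¹' (S : Set (Literal Val))) :=
      fun a _ b _ hab => enc_injective (Prod.mk.inj hab).1
    refine ⟨S.preimage _ hinj, ?_, fun c hc => ?_⟩
    · refine le_trans ?_ hS
      rw [← Finset.card_image_of_injOn (s := S.preimage _ hinj) (by simpa using hinj)]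
      apply Finset.card_le_card
      intro l hl
      obtain ⟨v, hv, rfl⟩ := Finset.mem_image.1 hl
      simpa only [Finset.mem_preimage] using hv
    · obtain ⟨l, hl, hlS⟩ := h _ (mem_toCNF_positiveCNF.2 ⟨c, hc, rfl⟩)
      simp only [List.mem_toFinset, List.mem_map] at hl
      obtain ⟨v, hv, rfl⟩ := hl
      exact ⟨v, hv, Finset.mem_preimage.2 hlS⟩
  · rintro ⟨H, hH, h⟩
    refine ⟨H.image fun v => (enc v, true), Finset.card_image_le.trans hH, ?_, fun c hc => ?_⟩
    · simp
    · obtain ⟨d, hd, rfl⟩ := mem_toCNF_positiveCNF.1 hc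
      obtain ⟨v, hv, hvH⟩ := h d hd
      exact ⟨(enc v, true), List.mem_toFinset.2 (List.mem_map_of_mem hv),
        Finset.mem_image_of_mem _ hvH⟩

/-! ### Hitting Set -/

/-- Each set becomes the clause of the positive literals of its elements; the parameter is kept. -/
theorem hittingSet_fptReduces : FPTReduces hittingSet weakEBackdoor := by
  refine (FPTReduces.refl hittingSet).trans_polyTime
    (f := fun z : Val × ℕ => (positiveCNF (z.1.toList.map Val.toList), z.2)) ?_ 1 (by simp) ?_
  · exact .prodMk (.positiveCNF (.map (f := fun _ (b : Val) => b.toList) (by fun_prop)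
      (by fun_prop))) (by fun_prop)
  · intro x k
    rw [positiveCNF_mem_weakEBackdoor]
    simp only [hittingSet, Set.mem_ofPred_eq, Val.toFamily, List.mem_toFinset, List.mem_map,
      forall_exists_index, and_imp, forall_apply_eq_imp_iff₂]
    refine exists_congr fun H => and_congr_right fun _ => forall₂_congr fun c _ => ?_
    simp [Finset.Nonempty]

/-! ### Weak backdoors belong to W[2] -/

theorem toStructure_enc_univ (τ : Vocabulary) {U : List Val} (hU : U ≠ [])
    (R : List (List (List Val))) :
    ((enc (U, R)).toStructure τ).univ = U.toFinset := by
  cases U with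
  | nil => exact absurd rfl hU
  | cons u U =>
    change (u :: (enc U).toList).toFinset = _
    rw [toList_enc]
    congr 2
    exact List.map_id _

theorem mem_toStructure_enc_rel (τ : Vocabulary) {U : List Val} (hU : U ≠ [])
    (R : List (List (List Val))) (i : Fin τ.num) (a : Fin (τ.arity i) → Val) :
    a ∈ ((enc (U, R)).toStructure τ).rel i ↔
      (∀ j, a j ∈ U) ∧ List.ofFn a ∈ R.getD i [] := by
  have h1 : ∀ j, a j ∈ ((enc (U, R)).toStructure τ).univ ↔ a j ∈ U := fun j => by
    rw [toStructure_enc_univ τ hU, List.mem_toFinset]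
  have h2 : (((enc (U, R)).tl.toList.getD i Val.nil).toList.map Val.toList) = R.getD i [] := by
    change (((enc R).toList.getD i (enc ([] : List (List Val)))).toList.map Val.toList) = _
    rw [toList_enc, List.getD_map, toList_enc, List.map_map]
    refine List.map_id'' (fun l => ?_) _
    change (enc l).toList = l
    rw [toList_enc]
    exact List.map_id _
  rw [← h2]
  exact and_congr_left fun _ => forall_congr' h1

/-- The literals and clauses that a data value represents. -/
def parseCNF (x : Val) : List (List (Literal Val)) :=
  x.toList.map fun c => c.toList.map fun l => l.toLiteral

@[fun_prop] theorem PolyTime.parseCNF {f : α → Val} (hf : PolyTime f) :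
    PolyTime fun a => parseCNF (f a) := by
  have h : PolyTime fun l : Val => l.toLiteral := by
    have : PolyTime fun l : Val => (l.tl, !decide (l.hd = Val.nil)) := by fun_prop
    simpa [Val.toLiteral] using this
  have h1 : PolyTime fun z : α × Val => z.2.toList.map fun l => l.toLiteral :=
    map (f := fun _ l => Val.toLiteral l) (h.comp (snd id)) (val_toList (snd id))
  exact map (f := fun _ (c : Val) => c.toList.map fun l => l.toLiteral) h1 (val_toList hf)

theorem mem_toCNF {x : Val} {c : Clause Val} :
    c ∈ x.toCNF ↔ ∃ d ∈ parseCNF x, d.toFinset = c := by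
  simp [Val.toCNF, parseCNF]

/-- The vocabulary with three binary relations: being a clause (on the diagonal), membership of a
literal in a clause, and complementarity of literals. -/
def cnfVocabulary : Vocabulary := ⟨3, fun _ => 2⟩

/-- The formula which says that the set `X` meets every clause and does not contain complementary
literals. -/
def hittingFormula : Pi2Formula where
  voc := cnfVocabulary
  arityX := 1
  p := 3
  q := 1
  matrix :=
    .and (.or (.not (.rel (0 : Fin 3) fun _ => .inl 0))
        (.and (.X fun _ => .inr 0) (.rel (1 : Fin 3) ![.inr 0, .inl 0])))
      (.not (.and (.rel (2 : Fin 3) ![.inl 1, .inl 2])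
        (.and (.X fun _ => .inl 1) (.X fun _ => .inl 2))))

/-- The element for a literal. -/
def litVal (l : Literal Val) : Val := enc (0, l)

/-- The element for a clause. -/
def clauseVal (c : List (Literal Val)) : Val := enc (1, c)

/-- An element without meaning, which serves to fill up sets. -/
def dummyVal (n : ℕ) : Val := enc (2, n)

theorem litVal_injective : Function.Injective litVal := fun _ _ h =>
  (Prod.mk.inj (enc_injective h)).2

theorem clauseVal_injective : Function.Injective clauseVal := fun _ _ h =>
  (Prod.mk.inj (enc_injective h)).2

theorem dummyVal_injective : Function.Injective dummyVal := fun _ _ h =>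
  (Prod.mk.inj (enc_injective h)).2

theorem litVal_ne_dummyVal (l : Literal Val) (n : ℕ) : litVal l ≠ dummyVal n := fun h => by
  have h1 : enc (0 : ℕ) = enc 2 := (Val.cons.inj h).1
  exact absurd (enc_injective h1) (by norm_num)

/-- The universe of the structure for a formula. -/
def cnfUniverse (F : List (List (Literal Val))) (k : ℕ) : List Val :=
  (List.range (k + 1)).map dummyVal ++ (F.flatten.map litVal ++ F.map clauseVal)

/-- The relations of the structure for a formula. -/
def cnfRelations (F : List (List (Literal Val))) : List (List (List Val)) :=
  [F.map fun c => [clauseVal c, clauseVal c],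
    F.flatMap fun c => c.map fun l => [litVal l, clauseVal c],
    F.flatten.map fun l => [litVal l, litVal (l.1, !l.2)]]

theorem polyTime_cnfStructure :
    PolyTime fun z : Val × ℕ => (cnfUniverse (parseCNF z.1) z.2, cnfRelations (parseCNF z.1)) := by
  have h0 : PolyTime litVal := .enc_comp (by fun_prop)
  have h1 : PolyTime clauseVal := .enc_comp (by fun_prop)
  have h2 : PolyTime dummyVal := .enc_comp (by fun_prop)
  unfold cnfUniverse cnfRelations
  fun_prop

theorem cnfUniverse_ne_nil (F : List (List (Literal Val))) (k : ℕ) : cnfUniverse F k ≠ [] := by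
  simp [cnfUniverse]

/-- The tags in `litVal` and `clauseVal` turn the relations of the structure into statements about
literals and clauses, so that later arguments need not mention the encoding of structures. -/
theorem hittingFormula_holds {F : List (List (Literal Val))} {k : ℕ} {T : Finset (Fin 1 → Val)} :
    hittingFormula.Holds ((enc (cnfUniverse F k, cnfRelations F)).toStructure cnfVocabulary) T ↔
      ∀ c x x', c ∈ cnfUniverse F k → x ∈ cnfUniverse F k → x' ∈ cnfUniverse F k →
        ∃ y ∈ cnfUniverse F k,
          ((∃ d ∈ F, c = clauseVal d) → (fun _ => y) ∈ T ∧
            ∃ d ∈ F, ∃ l ∈ d, y = litVal l ∧ c = clauseVal d) ∧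
          ¬ ((∃ l ∈ F.flatten, x = litVal l ∧ x' = litVal (l.1, !l.2)) ∧
            (fun _ => x) ∈ T ∧ (fun _ => x') ∈ T) := by
  have hU := cnfUniverse_ne_nil F k
  set A := (enc (cnfUniverse F k, cnfRelations F)).toStructure cnfVocabulary with hA
  have hu : ∀ v, v ∈ A.univ ↔ v ∈ cnfUniverse F k := fun v => by
    rw [hA, toStructure_enc_univ _ hU, List.mem_toFinset]
  have hrel : ∀ (i : Fin 3) (a : Fin 2 → Val), a 0 ∈ cnfUniverse F k → a 1 ∈ cnfUniverse F k →
      (a ∈ A.rel i ↔ [a 0, a 1] ∈ (cnfRelations F).getD i []) := by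
    intro i a h0 h1
    refine (mem_toStructure_enc_rel cnfVocabulary hU _ i a).trans ?_
    have h2 : List.ofFn a = [a 0, a 1] := by simp
    have h3 : ∀ j : Fin 2, a j ∈ cnfUniverse F k := by
      intro j; fin_cases j <;> assumption
    exact ⟨fun h => h2 ▸ h.2, fun h => ⟨h3, h2.symm ▸ h⟩⟩
  have key : ∀ (a : Fin 3 → Val) (b : Fin 1 → Val), (∀ i, a i ∈ A.univ) → (∀ i, b i ∈ A.univ) →
      (hittingFormula.matrix.Holds A T (Sum.elim a b) ↔
        ((∃ d ∈ F, a 0 = clauseVal d) → (fun _ => b 0) ∈ T ∧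
          ∃ d ∈ F, ∃ l ∈ d, b 0 = litVal l ∧ a 0 = clauseVal d) ∧
        ¬ ((∃ l ∈ F.flatten, a 1 = litVal l ∧ a 2 = litVal (l.1, !l.2)) ∧
          (fun _ => a 1) ∈ T ∧ (fun _ => a 2) ∈ T)) := by
    intro a b ha hb
    simp only [hu] at ha hb
    change ((¬ (fun _ : Fin 2 => a 0) ∈ A.rel (0 : Fin 3) ∨ (fun _ => b 0) ∈ T ∧
      (fun j : Fin 2 => Sum.elim a b (![.inr 0, .inl 0] j)) ∈ A.rel (1 : Fin 3)) ∧
      ¬ ((fun j : Fin 2 => Sum.elim a b (![.inl 1, .inl 2] j)) ∈ A.rel (2 : Fin 3) ∧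
        (fun _ => a 1) ∈ T ∧ (fun _ => a 2) ∈ T)) ↔ _
    rw [hrel 0 _ (ha _) (ha _), hrel 1 _ (hb _) (ha _), hrel 2 _ (ha _) (ha _)]
    have e0 : [a 0, a 0] ∈ (cnfRelations F).getD (0 : Fin 3) [] ↔ ∃ d ∈ F, a 0 = clauseVal d := by
      simp [cnfRelations, eq_comm]
    have e1 : [b 0, a 0] ∈ (cnfRelations F).getD (1 : Fin 3) [] ↔
        ∃ d ∈ F, ∃ l ∈ d, b 0 = litVal l ∧ a 0 = clauseVal d := by
      simp only [cnfRelations, List.getD, Fin.val_one, List.getElem?_cons_succ,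
        List.getElem?_cons_zero, Option.getD_some, List.mem_flatMap, List.mem_map, List.cons.injEq,
        and_true]
      simp only [eq_comm]
    have e2 : [a 1, a 2] ∈ (cnfRelations F).getD (2 : Fin 3) [] ↔
        ∃ l ∈ F.flatten, a 1 = litVal l ∧ a 2 = litVal (l.1, !l.2) := by
      simp only [cnfRelations, List.getD, Fin.val_two, List.getElem?_cons_succ,
        List.getElem?_cons_zero, Option.getD_some, List.mem_map, List.cons.injEq,
        and_true]
      simp only [eq_comm]
    exact and_congr ((or_congr_left (not_congr e0)).trans ((or_congr_right (and_congr_right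
      fun _ => e1)).trans imp_iff_not_or.symm)) (not_congr (and_congr_left fun _ => e2))
  constructor
  · intro h c x x' hc hx hx'
    have ha : ∀ i, (![c, x, x'] : Fin 3 → Val) i ∈ A.univ := by
      intro i
      rw [hu]
      fin_cases i <;> assumption
    obtain ⟨b, hb, hm⟩ := h ![c, x, x'] ha
    exact ⟨b (0 : Fin 1), (hu _).1 (hb (0 : Fin 1)), (key _ _ ha hb).1 hm⟩
  · intro h a ha
    obtain ⟨y, hy, hm⟩ := h (a (0 : Fin 3)) (a (1 : Fin 3)) (a (2 : Fin 3)) ((hu _).1 (ha _))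
      ((hu _).1 (ha _)) ((hu _).1 (ha _))
    have hb : ∀ i : Fin 1, (fun _ => y : Fin 1 → Val) i ∈ A.univ := fun _ => (hu _).2 hy
    exact ⟨fun _ => y, hb, (key a _ ha hb).2 hm⟩

theorem litVal_mem_cnfUniverse {F : List (List (Literal Val))} {k : ℕ} {l : Literal Val}
    (h : l ∈ F.flatten) : litVal l ∈ cnfUniverse F k := by
  simp only [cnfUniverse, List.mem_append]
  exact Or.inr (Or.inl (List.mem_map_of_mem h))

theorem clauseVal_mem_cnfUniverse {F : List (List (Literal Val))} {k : ℕ}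
    {c : List (Literal Val)} (h : c ∈ F) : clauseVal c ∈ cnfUniverse F k := by
  simp only [cnfUniverse, List.mem_append]
  exact Or.inr (Or.inr (List.mem_map_of_mem h))

theorem dummyVal_mem_cnfUniverse {F : List (List (Literal Val))} {k n : ℕ} (h : n ≤ k) :
    dummyVal n ∈ cnfUniverse F k := by
  simp only [cnfUniverse, List.mem_append]
  exact Or.inl (List.mem_map_of_mem (List.mem_range.2 (by omega)))

/-- Weighted definability asks for cardinality exactly `k`. Dummy elements lie in no clause and in
no complementary pair, so they fill up a smaller solution without any effect on the formula. -/
theorem exists_hitting_iff_weightedDef (F : List (List (Literal Val))) (k : ℕ) :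
    (∃ S : Finset (Literal Val), S.card ≤ k ∧ (∀ l ∈ S, (l.1, !l.2) ∉ S) ∧
      ∀ c ∈ F, ∃ l ∈ c, l ∈ S) ↔
    (enc (cnfUniverse F k, cnfRelations F), k) ∈ weightedDef hittingFormula := by
  have hU := cnfUniverse_ne_nil F k
  have hinj : Function.Injective fun (l : Literal Val) (_ : Fin 1) => litVal l := fun a b h =>
    litVal_injective (congrFun h 0)
  have hinj' : Function.Injective fun (n : ℕ) (_ : Fin 1) => dummyVal n := fun a b h =>
    dummyVal_injective (congrFun h 0)
  constructor
  · rintro ⟨S, hS, hcons, hF⟩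
    -- Literals of `S` that do not occur in `F` need not name elements of the universe, hence the
    -- filter.
    set S₀ : Finset (Fin 1 → Val) := (S.filter fun l => l ∈ F.flatten).image fun l _ => litVal l
    set D : Finset (Fin 1 → Val) := (Finset.range (k + 1)).image fun n _ => dummyVal n
    have h1 : S₀.card ≤ k := Finset.card_image_le.trans ((Finset.card_filter_le _ _).trans hS)
    have h2 : k ≤ (S₀ ∪ D).card := by
      have : D.card = k + 1 := by rw [Finset.card_image_of_injective _ hinj', Finset.card_range]
      have := Finset.card_le_card (Finset.subset_union_right (s₁ := S₀) (s₂ := D))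
      omega
    obtain ⟨T, hST, hTD, hT⟩ := Finset.exists_subsuperset_card_eq
      (Finset.subset_union_left (s₁ := S₀) (s₂ := D)) h1 h2
    have hTlit : ∀ l, (fun _ => litVal l) ∈ T → l ∈ S := by
      intro l hl
      rcases Finset.mem_union.1 (hTD hl) with h | h
      · obtain ⟨l', hl', he⟩ := Finset.mem_image.1 h
        rw [← hinj he]
        exact (Finset.mem_filter.1 hl').1
      · obtain ⟨n, _, he⟩ := Finset.mem_image.1 h
        exact absurd (congrFun he 0).symm (litVal_ne_dummyVal _ _)
    refine ⟨T, fun a ha j => ?_, hT, hittingFormula_holds.2 fun c x x' hc hx hx' => ?_⟩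
    · change a j ∈ ((enc (cnfUniverse F k, cnfRelations F)).toStructure cnfVocabulary).univ
      rw [toStructure_enc_univ _ hU, List.mem_toFinset]
      rcases Finset.mem_union.1 (hTD ha) with h | h
      · obtain ⟨l, hl, rfl⟩ := Finset.mem_image.1 h
        exact litVal_mem_cnfUniverse (Finset.mem_filter.1 hl).2
      · obtain ⟨n, hn, rfl⟩ := Finset.mem_image.1 h
        exact dummyVal_mem_cnfUniverse (Nat.lt_succ_iff.1 (Finset.mem_range.1 hn))
    · have hneg : ¬ ((∃ l ∈ F.flatten, x = litVal l ∧ x' = litVal (l.1, !l.2)) ∧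
          (fun _ => x) ∈ T ∧ (fun _ => x') ∈ T) := by
        rintro ⟨⟨l, _, rfl, rfl⟩, h3, h4⟩
        exact hcons l (hTlit _ h3) (hTlit _ h4)
      by_cases hcl : ∃ d ∈ F, c = clauseVal d
      · obtain ⟨d, hd, rfl⟩ := hcl
        obtain ⟨l, hl, hlS⟩ := hF d hd
        have hlF : l ∈ F.flatten := List.mem_flatten.2 ⟨d, hd, hl⟩
        exact ⟨litVal l, litVal_mem_cnfUniverse hlF, fun _ => ⟨hST (Finset.mem_image.2
          ⟨l, Finset.mem_filter.2 ⟨hlS, hlF⟩, rfl⟩), d, hd, l, hl, rfl, rfl⟩, hneg⟩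
      · exact ⟨c, hc, fun h => absurd h hcl, hneg⟩
  · rintro ⟨T, -, hT, h⟩
    replace h := hittingFormula_holds.1 h
    -- The dummy with index 0 exists even for `k = 0`. It instantiates the universal variables that
    -- play no role in the conjunct under consideration.
    have hd := dummyVal_mem_cnfUniverse (F := F) (Nat.zero_le k)
    refine ⟨F.flatten.toFinset.filter fun l => (fun _ => litVal l) ∈ T, ?_, ?_, fun c hc => ?_⟩
    · refine le_trans ?_ hT.le
      rw [← Finset.card_image_of_injective _ hinj]
      refine Finset.card_le_card fun a ha => ?_
      obtain ⟨l, hl, rfl⟩ := Finset.mem_image.1 ha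
      exact (Finset.mem_filter.1 hl).2
    · intro l hl hl'
      simp only [Finset.mem_filter, List.mem_toFinset] at hl hl'
      obtain ⟨_, _, _, h2⟩ := h _ _ _ hd (litVal_mem_cnfUniverse hl.1)
        (litVal_mem_cnfUniverse hl'.1)
      exact h2 ⟨⟨l, hl.1, rfl, rfl⟩, hl.2, hl'.2⟩
    · obtain ⟨y, _, h1, _⟩ := h _ _ _ (clauseVal_mem_cnfUniverse hc) hd hd
      obtain ⟨hyT, d, hdF, l, hl, rfl, he⟩ := h1 ⟨c, hc, rfl⟩
      obtain rfl := clauseVal_injective he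
      exact ⟨l, hl, Finset.mem_filter.2 ⟨List.mem_toFinset.2 (List.mem_flatten.2 ⟨c, hc, hl⟩), hyT⟩⟩

theorem mem_weakEBackdoor_iff_parseCNF {x : Val} {k : ℕ} : (x, k) ∈ weakEBackdoor ↔
    ∃ S : Finset (Literal Val), S.card ≤ k ∧ (∀ l ∈ S, (l.1, !l.2) ∉ S) ∧
      ∀ c ∈ parseCNF x, ∃ l ∈ c, l ∈ S := by
  rw [mem_weakEBackdoor]
  refine exists_congr fun S => and_congr_right fun _ => and_congr_right fun _ => ?_
  simp only [mem_toCNF, forall_exists_index, and_imp, forall_apply_eq_imp_iff₂, List.mem_toFinset]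

theorem weakEBackdoor_mem_W2 : weakEBackdoor ∈ W2 := by
  refine ⟨hittingFormula, (FPTReduces.refl _).trans_polyTime
    (f := fun z : Val × ℕ => ((cnfUniverse (parseCNF z.1) z.2, cnfRelations (parseCNF z.1)), z.2))
    (polyTime_cnfStructure.prodMk (by fun_prop)) 1 (by simp) fun x k => ?_⟩
  rw [mem_weakEBackdoor_iff_parseCNF]
  exact exists_hitting_iff_weightedDef _ _

/-! ### Choices for slots and for tuples of slots as a hitting set problem -/

/-- All pairs. -/
def pairs {α β : Type} (l : List α) (l' : List β) : List (α × β) :=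
  l.flatMap fun a => l'.map fun b => (a, b)

theorem mem_pairs {α β : Type} {l : List α} {l' : List β} {z : α × β} :
    z ∈ pairs l l' ↔ z.1 ∈ l ∧ z.2 ∈ l' := by
  obtain ⟨a, b⟩ := z
  simp [pairs]

@[fun_prop] theorem PolyTime.pairs {l : α → List β} {l' : α → List γ} (hl : PolyTime l)
    (hl' : PolyTime l') : PolyTime fun a => pairs (l a) (l' a) := by
  unfold ParamComplexity.pairs
  exact flatMap (f := fun a b => (l' a).map fun c => (b, c))
    (map (f := fun z c => (z.2, c)) (by fun_prop) (hl'.comp (fst id))) hl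

/-- Clauses for choosing a value from `Γ` for each slot `i < n` and, consistently, for each
`m`-tuple of slots the tuple of the values; `E` are additional clauses on the values of single
slots, `R` on tuples of values. -/
def selectionClauses {γ : Type} [DecidableEq γ] (n m : ℕ) (Γ : List γ) (E : List (List (ℕ × γ)))
    (R : List (List (List (ℕ × γ)))) : List (List (Bool × List (ℕ × γ))) :=
  ((List.range n).map fun i => Γ.map fun g => (true, [(i, g)])) ++
    (E.map fun e => e.map fun z => (true, [z])) ++
    ((tuples (List.range n) m).map fun κ =>
      ((tuples (pairs (List.range n) Γ) m).filter fun l => decide (l.map Prod.fst = κ)).map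
        fun l => (false, l)) ++
    ((pairs (tuples (List.range n) m) (pairs (List.range n) Γ)).map fun z =>
      (true, [z.2]) :: ((tuples (pairs (List.range n) Γ) m).filter fun l =>
        decide (l.map Prod.fst = z.1) && !decide (z.2 ∈ l)).map fun l => (false, l)) ++
    R.map fun r => r.map fun l => (false, l)

theorem PolyTime.selectionClauses [DecidableEq γ] {n : α → ℕ} (m : ℕ) {Γ : α → List γ}
    {E : α → List (List (ℕ × γ))} {R : α → List (List (List (ℕ × γ)))} (hn : PolyTime n)
    (hΓ : PolyTime Γ) (hE : PolyTime E) (hR : PolyTime R) :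
    PolyTime fun a => selectionClauses (n a) m (Γ a) (E a) (R a) := by
  have h : PolyTime fun z : ℕ × List γ × List (List (ℕ × γ)) × List (List (List (ℕ × γ))) =>
      ParamComplexity.selectionClauses z.1 m z.2.1 z.2.2.1 z.2.2.2 := by
    unfold ParamComplexity.selectionClauses
    fun_prop
  exact h.comp (hn.prodMk (hΓ.prodMk (hE.prodMk hR)))

/-- There are `n + n ^ m` slots and `m`-tuples of slots, each with a clause of its own, and elements
for different ones are different. The budget therefore allows exactly one element for each. Once
choices are unique, a negated choice can be expressed positively as "some other choice", which
yields the clauses that tie the tuples to the single slots. -/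
theorem selectionClauses_iff {γ : Type} [DecidableEq γ] [Inhabited γ] {n m : ℕ} {Γ : List γ}
    {E : List (List (ℕ × γ))} {R : List (List (List (ℕ × γ)))}
    (hE : ∀ e ∈ E, ∀ z ∈ e, z.1 < n)
    (hR : ∀ r ∈ R, ∀ l ∈ r, l ∈ tuples (pairs (List.range n) Γ) m) :
    (∃ H : Finset (Bool × List (ℕ × γ)), H.card ≤ n + n ^ m ∧
      ∀ c ∈ selectionClauses n m Γ E R, ∃ v ∈ c, v ∈ H) ↔
    ∃ G : ℕ → γ, (∀ i < n, G i ∈ Γ) ∧ (∀ e ∈ E, ∃ z ∈ e, z.2 = G z.1) ∧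
      ∀ r ∈ R, ∃ l ∈ r, ∀ z ∈ l, z.2 = G z.1 := by
  set key : Bool × List (ℕ × γ) → Bool × List ℕ := fun v => (v.1, v.2.map Prod.fst) with hkey
  constructor
  · rintro ⟨H, hH, h⟩
    simp only [selectionClauses, List.mem_append, or_imp, forall_and] at h
    obtain ⟨⟨⟨⟨h1, h2⟩, h3⟩, h4⟩, h5⟩ := h
    have h1' : ∀ i < n, ∃ g ∈ Γ, (true, [(i, g)]) ∈ H := by
      intro i hi
      obtain ⟨v, hv, hvH⟩ := h1 _ (List.mem_map_of_mem (List.mem_range.2 hi))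
      obtain ⟨g, hg, rfl⟩ := List.mem_map.1 hv
      exact ⟨g, hg, hvH⟩
    have h3' : ∀ κ ∈ tuples (List.range n) m, ∃ l, l.map Prod.fst = κ ∧ (false, l) ∈ H := by
      intro κ hκ
      obtain ⟨v, hv, hvH⟩ := h3 _ (List.mem_map_of_mem hκ)
      obtain ⟨l, hl, rfl⟩ := List.mem_map.1 hv
      exact ⟨l, by simpa using (List.mem_filter.1 hl).2, hvH⟩
    -- `K` lists the keys that must occur in `H`, and its length equals the budget. Hence `key` is
    -- injective on `H`.
    set K : List (Bool × List ℕ) := ((List.range n).map fun i => (true, [i])) ++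
      (tuples (List.range n) m).map fun κ => (false, κ) with hK
    have hKnodup : K.Nodup := by
      refine List.Nodup.append (List.nodup_range.map fun a b hab => by simpa using hab)
        ((nodup_tuples List.nodup_range m).map fun a b hab => by simpa using hab) ?_
      intro z hz hz'
      obtain ⟨i, _, rfl⟩ := List.mem_map.1 hz
      obtain ⟨κ, _, hκ⟩ := List.mem_map.1 hz'
      simp at hκ
    have hKH : K.toFinset ⊆ H.image key := by
      intro z hz
      rcases List.mem_append.1 (List.mem_toFinset.1 hz) with hz | hz
      · obtain ⟨i, hi, rfl⟩ := List.mem_map.1 hz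
        obtain ⟨g, _, hg⟩ := h1' i (List.mem_range.1 hi)
        exact Finset.mem_image.2 ⟨_, hg, rfl⟩
      · obtain ⟨κ, hκ, rfl⟩ := List.mem_map.1 hz
        obtain ⟨l, rfl, hl⟩ := h3' κ hκ
        exact Finset.mem_image.2 ⟨_, hl, rfl⟩
    have hcard : (H.image key).card = H.card := by
      refine le_antisymm Finset.card_image_le (hH.trans (le_trans ?_ (Finset.card_le_card hKH)))
      rw [List.toFinset_card_of_nodup hKnodup, hK]
      simp [length_tuples]
    have hinj := Finset.card_image_iff.1 hcard
    have hG : ∀ i, ∃ g, i < n → g ∈ Γ ∧ (true, [(i, g)]) ∈ H := by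
      intro i
      by_cases hi : i < n
      · obtain ⟨g, hg⟩ := h1' i hi
        exact ⟨g, fun _ => hg⟩
      · exact ⟨default, fun h => absurd h hi⟩
    choose G hG using hG
    have hsingle : ∀ z : ℕ × γ, z.1 < n → (true, [z]) ∈ H → z.2 = G z.1 := by
      rintro ⟨i, g⟩ hi hz
      have := hinj hz (hG i hi).2 rfl
      simpa using this
    refine ⟨G, fun i hi => (hG i hi).1, fun e he => ?_, fun r hr => ?_⟩
    · obtain ⟨v, hv, hvH⟩ := h2 _ (List.mem_map_of_mem he)
      obtain ⟨z, hz, rfl⟩ := List.mem_map.1 hv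
      exact ⟨z, hz, hsingle z (hE e he z hz) hvH⟩
    · obtain ⟨v, hv, hvH⟩ := h5 _ (List.mem_map_of_mem hr)
      obtain ⟨l, hl, rfl⟩ := List.mem_map.1 hv
      refine ⟨l, hl, fun z hz => ?_⟩
      have hlt := mem_tuples.1 (hR r hr l hl)
      have hzP := hlt.2 z hz
      have hκ : l.map Prod.fst ∈ tuples (List.range n) m := by
        refine mem_tuples.2 ⟨by simpa using hlt.1, fun i hi => ?_⟩
        obtain ⟨w, hw, rfl⟩ := List.mem_map.1 hi
        exact (mem_pairs.1 (hlt.2 w hw)).1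
      -- The consistency clause for the slots of `l` and the entry `z`: either `z` is chosen as a
      -- single, or a tuple for the same slots without `z` is chosen. The latter would equal `l` by
      -- injectivity of `key`, but `l` contains `z`.
      obtain ⟨v, hv, hvH'⟩ := h4 _ (List.mem_map_of_mem
        ((mem_pairs (z := (l.map Prod.fst, z))).2 ⟨hκ, hzP⟩))
      rcases List.mem_cons.1 hv with rfl | hv
      · exact hsingle z (List.mem_range.1 (mem_pairs.1 hzP).1) hvH'
      · obtain ⟨l', hl', rfl⟩ := List.mem_map.1 hv
        have hl'2 := (List.mem_filter.1 hl').2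
        simp only [Bool.and_eq_true, decide_eq_true_eq, Bool.not_eq_true', decide_eq_false_iff_not]
          at hl'2
        have := hinj hvH' hvH (by simp only [hkey, hl'2.1])
        simp only [Prod.mk.injEq, true_and] at this
        exact absurd (this ▸ hz) hl'2.2
  · rintro ⟨G, hΓ, hGE, hGR⟩
    -- The hitting set consists of the graph of `G` on single slots and its restrictions to all
    -- `m`-tuples of slots.
    set L : List ℕ → List (ℕ × γ) := fun κ => κ.map fun i => (i, G i) with hL
    have hLfst : ∀ κ, (L κ).map Prod.fst = κ := fun κ => by simp [hL, Function.comp_def]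
    have hLmem : ∀ κ ∈ tuples (List.range n) m, L κ ∈ tuples (pairs (List.range n) Γ) m := by
      intro κ hκ
      have hκ' := mem_tuples.1 hκ
      refine mem_tuples.2 ⟨by simpa [hL] using hκ'.1, fun z hz => ?_⟩
      obtain ⟨i, hi, rfl⟩ := List.mem_map.1 hz
      have := hκ'.2 i hi
      exact mem_pairs.2 ⟨this, hΓ i (List.mem_range.1 this)⟩
    set H1 : Finset (Bool × List (ℕ × γ)) := (Finset.range n).image fun i => (true, [(i, G i)])
    set H2 : Finset (Bool × List (ℕ × γ)) :=
      (tuples (List.range n) m).toFinset.image fun κ => (false, L κ)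
    have m1 : ∀ i < n, (true, [(i, G i)]) ∈ H1 ∪ H2 := fun i hi =>
      Finset.mem_union_left _ (Finset.mem_image_of_mem _ (Finset.mem_range.2 hi))
    have m2 : ∀ κ ∈ tuples (List.range n) m, (false, L κ) ∈ H1 ∪ H2 := fun κ hκ =>
      Finset.mem_union_right _ (Finset.mem_image.2 ⟨κ, List.mem_toFinset.2 hκ, rfl⟩)
    refine ⟨H1 ∪ H2, (Finset.card_union_le _ _).trans (Nat.add_le_add ?_ ?_), ?_⟩
    · exact Finset.card_image_le.trans (by simp)
    · refine Finset.card_image_le.trans ((List.toFinset_card_le _).trans ?_)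
      simp [length_tuples]
    · simp only [selectionClauses, List.mem_append, or_imp, forall_and, List.mem_map,
        forall_exists_index, and_imp, forall_apply_eq_imp_iff₂]
      refine ⟨⟨⟨⟨fun i hi => ?_, fun e he => ?_⟩, fun κ hκ => ?_⟩, fun z hz => ?_⟩, fun r hr => ?_⟩
      · exact ⟨_, ⟨G i, hΓ i (List.mem_range.1 hi), rfl⟩, m1 i (List.mem_range.1 hi)⟩
      · obtain ⟨⟨i, g⟩, hz, hzG⟩ := hGE e he
        obtain rfl : g = G i := hzG
        exact ⟨_, ⟨_, hz, rfl⟩, m1 i (hE e he _ hz)⟩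
      · exact ⟨_, ⟨L κ, List.mem_filter.2 ⟨hLmem κ hκ, by simpa using hLfst κ⟩, rfl⟩, m2 κ hκ⟩
      · obtain ⟨κ, i, g⟩ := z
        have hz' := mem_pairs.1 hz
        by_cases hmem : (i, g) ∈ L κ
        · obtain ⟨j, hj, hji⟩ := List.mem_map.1 hmem
          simp only [Prod.mk.injEq] at hji
          obtain ⟨rfl, rfl⟩ := hji
          exact ⟨_, List.mem_cons_self, m1 j (List.mem_range.1 (mem_pairs.1 hz'.2).1)⟩
        · exact ⟨_, List.mem_cons_of_mem _ (List.mem_map_of_mem (List.mem_filter.2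
            ⟨hLmem κ hz'.1, by simpa [hLfst κ] using hmem⟩)), m2 κ hz'.1⟩
      · obtain ⟨l, hl, hlG⟩ := hGR r hr
        have hlt := mem_tuples.1 (hR r hr l hl)
        have hκ : l.map Prod.fst ∈ tuples (List.range n) m := by
          refine mem_tuples.2 ⟨by simpa using hlt.1, fun i hi => ?_⟩
          obtain ⟨w, hw, rfl⟩ := List.mem_map.1 hi
          exact (mem_pairs.1 (hlt.2 w hw)).1
        have hlL : L (l.map Prod.fst) = l := by
          rw [hL]
          simp only [List.map_map]
          refine (List.map_congr_left fun z hz => ?_).trans (List.map_id l)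
          simp [← hlG z hz]
        exact ⟨_, ⟨l, hl, rfl⟩, hlL ▸ m2 _ hκ⟩

/-! ### Sets as chains of suffixes -/

/-- The pairs of a nonempty suffix of `T` and a proper suffix of that suffix. -/
def gapsOf {α : Type} (T : List α) : List (List α × List α) :=
  T.tails.flatMap fun x => if x.isEmpty = true then [] else x.tail.tails.map fun y => (x, y)

theorem mem_gapsOf {α : Type} {T : List α} {g : List α × List α} :
    g ∈ gapsOf T ↔ g.1 <:+ T ∧ g.1 ≠ [] ∧ g.2 <:+ g.1.tail := by
  obtain ⟨x, y⟩ := g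
  simp only [gapsOf, List.mem_flatMap, List.mem_tails]
  constructor
  · rintro ⟨z, hz, h⟩
    by_cases hz0 : z = []
    · simp [hz0] at h
    · simp [hz0] at h
      obtain ⟨h1, rfl⟩ := h
      exact ⟨hz, hz0, h1⟩
  · rintro ⟨h1, h2, h3⟩
    exact ⟨x, h1, by simpa [h2] using h3⟩

@[fun_prop] theorem PolyTime.gapsOf {l : α → List β} (hl : PolyTime l) :
    PolyTime fun a => gapsOf (l a) := by
  unfold ParamComplexity.gapsOf
  fun_prop

/-- Chains of suffixes `T = x₀ ⊋ x₁ ⊋ … ⊋ x_k ⊋ []`, given as the sequence of the pairs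
`(x_i, x_{i+1})`. -/
structure IsSuffixChain {α : Type} (T : List α) (k : ℕ) (G : ℕ → List α × List α) : Prop where
  mem : ∀ i < k + 1, G i ∈ gapsOf T
  first : (G 0).1 = T
  last : (G k).2 = []
  next : ∀ i < k, (G i).2 = (G (i + 1)).1

theorem headD_cons_tail {α : Type} {l : List α} (h : l ≠ []) (d : α) : l.headD d :: l.tail = l := by
  cases l with
  | nil => exact absurd rfl h
  | cons a l => rfl

namespace IsSuffixChain

variable {α : Type} {T : List α} {k : ℕ} {G : ℕ → List α × List α}

theorem head_mem (h : IsSuffixChain T k G) (d : α) {i : ℕ} (hi : i < k + 1) :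
    (G i).1.headD d ∈ (G i).1 := by
  have := headD_cons_tail (mem_gapsOf.1 (h.mem i hi)).2.1 d
  rw [← this]
  exact List.mem_cons_self

theorem head_notMem_tail (h : IsSuffixChain T k G) (hT : T.Nodup) (d : α) {i : ℕ}
    (hi : i < k + 1) : (G i).1.headD d ∉ (G i).1.tail := by
  obtain ⟨h1, h2, -⟩ := mem_gapsOf.1 (h.mem i hi)
  have h3 := hT.sublist h1.sublist
  rw [← headD_cons_tail h2 d] at h3
  exact (List.nodup_cons.1 h3).1

/-- Each gap ends inside the tail of its first suffix, and the next gap starts where it ends; the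
inclusions compose. -/
theorem suffix_tail (h : IsSuffixChain T k G) {i j : ℕ} (hij : i < j) (hj : j < k + 1) :
    (G j).1 <:+ (G i).1.tail := by
  induction j with
  | zero => omega
  | succ j ih =>
    rw [← h.next j (by omega)]
    have h1 := (mem_gapsOf.1 (h.mem j (by omega))).2.2
    rcases Nat.lt_succ_iff_lt_or_eq.1 hij with h2 | rfl
    · exact h1.trans ((List.tail_suffix _).trans (ih h2 (by omega)))
    · exact h1

/-- The chain starts with all of `T` and ends with the empty list, so `u` drops out somewhere. -/
theorem exists_mem (h : IsSuffixChain T k G) {u : α} (hu : u ∈ T) :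
    ∃ i < k + 1, u ∈ (G i).1 ∧ u ∉ (G i).2 := by
  by_contra! hc
  have h1 : ∀ i < k + 1, u ∈ (G i).1 := by
    intro i
    induction i with
    | zero => intro _; rw [h.first]; exact hu
    | succ i ih =>
      intro hi
      rw [← h.next i (by omega)]
      exact hc i (by omega) (ih (by omega))
  have h2 := hc k (by omega) (h1 k (by omega))
  simp [h.last] at h2

/-- The set `S` consists of the first elements of the suffixes in the chain other than the first
suffix. -/
def Represents (T : List α) (k : ℕ) (G : ℕ → List α × List α) (d : α) (S : Finset α) : Prop :=
  ∀ i < k + 1, ∀ u ∈ (G i).1, u ∉ (G i).2 → u ∈ T.tail → (u ∈ S ↔ u = (G i).1.headD d)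

/-- The set consists of the heads of the suffixes with index `1, …, k`; they are distinct because
later suffixes avoid earlier heads. The head with index 0 is the sentinel and is left out. -/
theorem exists_finset [DecidableEq α] (h : IsSuffixChain T k G) (hT : T.Nodup) (d : α) :
    ∃ S : Finset α, S ⊆ T.tail.toFinset ∧ S.card = k ∧ Represents T k G d S := by
  have hlt : ∀ i j, i < j → j < k + 1 → (G j).1.headD d ≠ (G i).1.headD d := by
    intro i j hij hj he
    refine h.head_notMem_tail hT d (hij.trans hj) ?_
    rw [← he]
    exact (h.suffix_tail hij hj).subset (h.head_mem d hj)
  refine ⟨(Finset.Icc 1 k).image fun i => (G i).1.headD d, ?_, ?_, ?_⟩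
  · intro u hu
    obtain ⟨i, hi, rfl⟩ := Finset.mem_image.1 hu
    rw [Finset.mem_Icc] at hi
    have h1 := h.suffix_tail (i := 0) (j := i) (by omega) (by omega)
    rw [h.first] at h1
    exact List.mem_toFinset.2 (h1.subset (h.head_mem d (by omega)))
  · rw [Finset.card_image_of_injOn, Nat.card_Icc, Nat.add_sub_cancel]
    intro i hi j hj he
    simp only [Finset.coe_Icc, Set.mem_Icc] at hi hj
    by_contra hne
    rcases Nat.lt_or_gt_of_ne hne with h1 | h1
    · exact hlt i j h1 (by omega) he.symm
    · exact hlt j i h1 (by omega) he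
  · intro i hi u hu hu' huT
    simp only [Finset.mem_image, Finset.mem_Icc]
    constructor
    · rintro ⟨j, hj, rfl⟩
      -- A head with larger index lies beyond the end of gap `i`. A head with smaller index does not
      -- lie in the later suffix `(G i).1`.
      rcases Nat.lt_trichotomy i j with h1 | rfl | h1
      · exfalso
        apply hu'
        rw [h.next i (by omega)]
        rcases Nat.lt_or_eq_of_le (Nat.succ_le_of_lt h1) with h2 | h2
        · exact ((h.suffix_tail h2 (by omega)).trans (List.tail_suffix _)).subset
            (h.head_mem d (by omega))
        · rw [← Nat.succ_eq_add_one, h2]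
          exact h.head_mem d (by omega)
      · rfl
      · exact absurd ((h.suffix_tail h1 hi).subset hu) (h.head_notMem_tail hT d (by omega))
    · rintro rfl
      rcases Nat.eq_zero_or_pos i with rfl | h1
      · have := h.head_notMem_tail hT d hi
        rw [h.first] at this huT
        exact absurd huT this
      · exact ⟨i, ⟨h1, by omega⟩, rfl⟩

/-- Cut the list in front of each element of `S`: from each suffix remove the head and then
everything up to the next element of `S`. -/
theorem exists_chain [DecidableEq α] (b : α) (T : List α) (hT : (b :: T).Nodup) (d : α)
    (S : Finset α) (hS : S ⊆ T.toFinset) :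
    ∃ G, IsSuffixChain (b :: T) S.card G ∧ Represents (b :: T) S.card G d S := by
  set k := S.card with hk
  let x : ℕ → List α := fun i =>
    Nat.rec (b :: T) (fun _ y => y.tail.dropWhile fun u => decide (u ∉ S)) i
  have x0 : x 0 = b :: T := rfl
  have xs : ∀ i, x (i + 1) = (x i).tail.dropWhile fun u => decide (u ∉ S) := fun i => rfl
  have hfd : ∀ l : List α, (l.dropWhile fun u => decide (u ∉ S)).filter (fun u => decide (u ∈ S)) =
      l.filter fun u => decide (u ∈ S) := by
    intro l
    induction l with
    | nil => rfl
    | cons a l ih => by_cases ha : a ∈ S <;> simp [ha] ; simpa using ih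
  have hdh : ∀ l : List α, l.dropWhile (fun u => decide (u ∉ S)) ≠ [] →
      (l.dropWhile fun u => decide (u ∉ S)).headD d ∈ S := by
    intro l
    induction l with
    | nil => simp
    | cons a l ih => by_cases ha : a ∈ S <;> simp [ha] ; simpa using ih
  -- After `i` cuts the tail still contains `k - i` elements of `S`. So the next suffix is nonempty
  -- while `i < k`, and it is empty after the last cut.
  have inv : ∀ i ≤ k, x i <:+ b :: T ∧ x i ≠ [] ∧
      ((x i).tail.filter fun u => decide (u ∈ S)).length = k - i := by
    intro i
    induction i with
    | zero =>
      refine fun _ => ⟨List.suffix_rfl, by simp [x0], ?_⟩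
      rw [x0, List.tail_cons, hk, ← List.toFinset_card_of_nodup ((List.nodup_cons.1 hT).2.filter _),
        List.toFinset_filter]
      congr 1
      ext u
      simpa using fun hu => List.mem_toFinset.1 (hS hu)
    | succ i ih =>
      intro hi
      obtain ⟨h1, h2, h3⟩ := ih (by omega)
      have h4 := hfd (x i).tail
      rw [← xs] at h4
      have h5 : x (i + 1) ≠ [] := by
        intro h0
        rw [h0] at h4
        rw [← h4] at h3
        simp at h3
        omega
      refine ⟨?_, h5, ?_⟩
      · rw [xs]
        exact (List.dropWhile_suffix _).trans ((List.tail_suffix _).trans h1)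
      · have h6 := hdh (x i).tail (by rw [← xs]; exact h5)
        rw [← xs] at h6
        rw [← h4, ← headD_cons_tail h5 d, List.filter_cons_of_pos (by simpa using h6),
          List.length_cons] at h3
        omega
  have hxk : x (k + 1) = [] := by
    have h1 := (inv k le_rfl).2.2
    rw [Nat.sub_self, List.length_eq_zero_iff, ← hfd, ← xs, List.filter_eq_nil_iff] at h1
    by_contra h0
    have h2 := hdh (x k).tail (by rw [← xs]; exact h0)
    rw [← xs] at h2
    refine h1 ((x (k + 1)).headD d) ?_ (by simpa using h2)
    have h3 := List.mem_cons_self (a := (x (k + 1)).headD d) (l := (x (k + 1)).tail)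
    rwa [headD_cons_tail h0 d] at h3
  refine ⟨fun i => (x i, x (i + 1)), ⟨fun i hi => mem_gapsOf.2 ?_, x0, hxk, fun i _ => rfl⟩, ?_⟩
  · obtain ⟨h1, h2, -⟩ := inv i (by omega)
    exact ⟨h1, h2, List.dropWhile_suffix _⟩
  · intro i hi u hu hu' huT
    obtain ⟨h1, h2, -⟩ := inv i (by omega)
    simp only at hu hu' ⊢
    constructor
    · intro huS
      rw [← headD_cons_tail h2 d] at hu
      rcases List.mem_cons.1 hu with h3 | h3
      · exact h3
      · rw [← List.takeWhile_append_dropWhile (p := fun u => decide (u ∉ S)) (l := (x i).tail),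
          List.mem_append, ← xs] at h3
        rcases h3 with h3 | h3
        · have := List.mem_takeWhile_imp h3
          simp [huS] at this
        · exact absurd h3 hu'
    · rintro rfl
      cases i with
      | zero =>
        rw [x0] at huT
        exact absurd huT (List.nodup_cons.1 hT).1
      | succ i => exact hdh _ (by rw [← xs]; exact h2)

end IsSuffixChain

/-! ### Evaluation of quantifier-free formulas -/

/-- The list of the elements of the universe. -/
def structUniverse (x : Val) : List Val := x.hd.hd :: x.hd.tl.toList

/-- The list of the tuples in a relation. -/
def structRelation (x : Val) (i : ℕ) : List (List Val) :=
  (x.tl.toList.getD i Val.nil).toList.map fun t => t.toList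

namespace QF

variable {τ : Vocabulary} {s : ℕ} {ν : Type}

/-- The number of atoms with the relation variable. -/
def numAtoms : QF τ s ν → ℕ
  | .eq _ _ => 0
  | .rel _ _ => 0
  | .X _ => 1
  | .not φ => φ.numAtoms
  | .and φ ψ => φ.numAtoms + ψ.numAtoms
  | .or φ ψ => φ.numAtoms + ψ.numAtoms

/-- The tuples to which the relation variable is applied. -/
def atoms (v : ν → Val) : QF τ s ν → List (List Val)
  | .eq _ _ => []
  | .rel _ _ => []
  | .X a => [List.ofFn fun i => v (a i)]
  | .not φ => φ.atoms v
  | .and φ ψ => φ.atoms v ++ ψ.atoms v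
  | .or φ ψ => φ.atoms v ++ ψ.atoms v

/-- Evaluation of a formula, where the relation variable is given by a list. -/
def eval (x : Val) (H : List (List Val)) (v : ν → Val) : QF τ s ν → Bool
  | .eq i j => decide (v i = v j)
  | .rel R a => decide ((List.ofFn fun i => v (a i)) ∈ structRelation x R)
  | .X a => decide ((List.ofFn fun i => v (a i)) ∈ H)
  | .not φ => !φ.eval x H v
  | .and φ ψ => φ.eval x H v && ψ.eval x H v
  | .or φ ψ => φ.eval x H v || ψ.eval x H v

theorem length_atoms (v : ν → Val) (φ : QF τ s ν) : (φ.atoms v).length = φ.numAtoms := by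
  induction φ <;> simp_all [atoms, numAtoms]

theorem atoms_subset {v : ν → Val} {U : List Val} (hv : ∀ i, v i ∈ U) (φ : QF τ s ν) :
    ∀ u ∈ φ.atoms v, u ∈ tuples U s := by
  induction φ with
  | eq => simp [atoms]
  | rel => simp [atoms]
  | X a =>
    simp only [atoms, List.mem_singleton, forall_eq, mem_tuples, List.length_ofFn, true_and]
    intro w hw
    obtain ⟨i, rfl⟩ := List.mem_ofFn.1 hw
    exact hv _
  | not φ ih => exact ih
  | and φ ψ h1 h2 | or φ ψ h1 h2 =>
    intro u hu
    rcases List.mem_append.1 hu with h | h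
    exacts [h1 u h, h2 u h]

/-- The list `H` needs to agree with `S` only on the tuples that occur in the formula. This permits
evaluation from the heads of a few gaps without knowledge of all of `S`. -/
theorem eval_eq_true_iff {x : Val} {H : List (List Val)} {v : ν → Val} {S : Finset (Fin s → Val)}
    (hv : ∀ i, v i ∈ structUniverse x) (φ : QF τ s ν)
    (hH : ∀ a : Fin s → Val, List.ofFn a ∈ φ.atoms v → (List.ofFn a ∈ H ↔ a ∈ S)) :
    φ.eval x H v = true ↔ φ.Holds (x.toStructure τ) S v := by
  induction φ with
  | eq i j => simp [eval, Holds]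
  | rel R a =>
    simp only [eval, Holds, decide_eq_true_eq]
    exact ⟨fun h => ⟨fun i => List.mem_toFinset.2 (hv _), h⟩, fun h => h.2⟩
  | X a =>
    simp only [eval, Holds, decide_eq_true_eq]
    exact hH _ (by simp [atoms])
  | not φ ih => simp [eval, Holds, ← ih hH]
  | and φ ψ h1 h2 =>
    simp only [eval, Holds, Bool.and_eq_true]
    rw [h1 fun a ha => hH a (List.mem_append_left _ ha),
      h2 fun a ha => hH a (List.mem_append_right _ ha)]
  | or φ ψ h1 h2 =>
    simp only [eval, Holds, Bool.or_eq_true]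
    rw [h1 fun a ha => hH a (List.mem_append_left _ ha),
      h2 fun a ha => hH a (List.mem_append_right _ ha)]

theorem polyTime_atoms {v : α → ν → Val} (hv : ∀ i, PolyTime fun a => v a i) (φ : QF τ s ν) :
    PolyTime fun a => φ.atoms (v a) := by
  induction φ with
  | eq => exact .const _
  | rel => exact .const _
  | X t => exact .cons (.ofFn fun i => hv (t i)) (.const _)
  | not φ ih => exact ih
  | and φ ψ h1 h2 => exact h1.append h2
  | or φ ψ h1 h2 => exact h1.append h2

theorem polyTime_eval {v : α → ν → Val} (hv : ∀ i, PolyTime fun a => v a i) {x : α → Val}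
    (hx : PolyTime x) {H : α → List (List Val)} (hH : PolyTime H) (φ : QF τ s ν) :
    PolyTime fun a => φ.eval (x a) (H a) (v a) := by
  induction φ with
  | eq i j => exact .decide_eq (hv i) (hv j)
  | rel R t =>
    exact .decide_mem (.ofFn fun i => hv (t i))
      (.map (f := fun _ t => t.toList) (by fun_prop) (.val_toList (.getD_const (by fun_prop) _ _)))
  | X t => exact .decide_mem (.ofFn fun i => hv (t i)) hH
  | not φ ih => exact ih.not
  | and φ ψ h1 h2 => exact h1.and h2
  | or φ ψ h1 h2 => exact h1.or h2

end QF

/-! ### Hardness for W[2] -/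

/-- The assignment of values to variables that two lists describe. -/
def listAssignment {p q : ℕ} (a b : List Val) : Fin p ⊕ Fin q → Val :=
  Sum.elim (fun i => a.getD i Val.nil) (fun j => b.getD j Val.nil)

/-- A pair of lists of tuples, which describes an interval of tuples. -/
abbrev Gap : Type := List (List Val) × List (List Val)

/-- The gaps `gs` determine the truth value of all atoms with the relation variable, and with
these truth values the formula is true. -/
def gapEval {τ : Vocabulary} {s p q : ℕ} (φ : QF τ s (Fin p ⊕ Fin q)) (x : Val)
    (a b : List Val) (gs : List Gap) : Bool :=
  ((φ.atoms (listAssignment a b)).all fun u =>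
      gs.any fun g => decide (u ∈ g.1) && !decide (u ∈ g.2)) &&
    φ.eval x (gs.map fun g => g.1.headD []) (listAssignment a b)

theorem polyTime_gapEval {τ : Vocabulary} {s p q : ℕ} (φ : QF τ s (Fin p ⊕ Fin q)) :
    PolyTime fun z : Val × List Val × List Val × List Gap =>
      gapEval φ z.1 z.2.1 z.2.2.1 z.2.2.2 := by
  have hv : ∀ i, PolyTime fun z : Val × List Val × List Val × List Gap =>
      (listAssignment z.2.1 z.2.2.1 : Fin p ⊕ Fin q → Val) i := by
    rintro (i | i)
    · exact .getD_const (by fun_prop) _ _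
    · exact .getD_const (by fun_prop) _ _
  exact .and (.all (f := fun z u => z.2.2.2.any fun g : Gap =>
    decide (u ∈ g.1) && !decide (u ∈ g.2))
    (by fun_prop) (QF.polyTime_atoms hv φ)) (QF.polyTime_eval hv (by fun_prop) (by fun_prop) φ)

/-- All tuples of length `s`, preceded by a list of a different length. -/
def tupleList (s : ℕ) (x : Val) : List (List Val) :=
  List.replicate (s + 1) Val.nil :: (tuples (structUniverse x) s).dedup

/-- The sentinel has length `s + 1`, so it is none of the tuples. It serves as the head of slot 0,
whose gap holds the tuples before the first element of `S`. -/
theorem nodup_tupleList (s : ℕ) (x : Val) : (tupleList s x).Nodup := by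
  refine List.nodup_cons.2 ⟨fun h => ?_, List.nodup_dedup _⟩
  have := (mem_tuples.1 (List.mem_dedup.1 h)).1
  simp at this

/-- The clauses which say that the gaps of the slots `0, …, k` form a chain of suffixes. -/
def chainClauses (T : List (List Val)) (k : ℕ) : List (List (ℕ × Gap)) :=
  ((gapsOf T).filter fun g => decide (g.1 = T)).map (fun g => (0, g)) ::
    ((gapsOf T).filter fun g => decide (g.2 = [])).map (fun g => (k, g)) ::
    (pairs (List.range k) T.tails).map fun z =>
      (((gapsOf T).filter fun g => !decide (g.2 = z.2)).map fun g => (z.1, g)) ++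
        ((gapsOf T).filter fun g => decide (g.1 = z.2)).map fun g => (z.1 + 1, g)

theorem polyTime_chainClauses :
    PolyTime fun z : List (List Val) × ℕ => chainClauses z.1 z.2 := by
  unfold chainClauses
  fun_prop

/-- That slot `i + 1` starts where slot `i` ends is stated for each suffix `v`: slot `i` carries a
gap that does not end in `v`, or slot `i + 1` carries a gap that starts with `v`. This is a
disjunction of choices, without negation. -/
theorem chainClauses_iff {T : List (List Val)} {k : ℕ} {G : ℕ → Gap}
    (hG : ∀ i < k + 1, G i ∈ gapsOf T) :
    (∀ e ∈ chainClauses T k, ∃ z ∈ e, z.2 = G z.1) ↔ IsSuffixChain T k G := by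
  simp only [chainClauses, List.mem_cons, forall_eq_or_imp, List.mem_map,
    forall_exists_index, and_imp, forall_apply_eq_imp_iff₂]
  constructor
  · rintro ⟨⟨_, ⟨g, hg, rfl⟩, h1⟩, ⟨_, ⟨g', hg', rfl⟩, h2⟩, h3⟩
    refine ⟨hG, ?_, ?_, fun i hi => ?_⟩
    · rw [← h1]
      simpa using (List.mem_filter.1 hg).2
    · rw [← h2]
      simpa using (List.mem_filter.1 hg').2
    · obtain ⟨h4, -, h5⟩ := mem_gapsOf.1 (hG i (by omega))
      obtain ⟨z, hz, hzG⟩ := h3 (i, (G i).2) (mem_pairs.2 ⟨List.mem_range.2 hi,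
        (List.mem_tails _ _).2 (h5.trans ((List.tail_suffix _).trans h4))⟩)
      rcases List.mem_append.1 hz with hz | hz
      · obtain ⟨g, hg, rfl⟩ := List.mem_map.1 hz
        have := (List.mem_filter.1 hg).2
        simp only at hzG
        simp [hzG] at this
      · obtain ⟨g, hg, rfl⟩ := List.mem_map.1 hz
        have := (List.mem_filter.1 hg).2
        simp only at hzG
        simpa [hzG, eq_comm] using this
  · intro h
    refine ⟨⟨_, ⟨G 0, List.mem_filter.2 ⟨hG 0 (by omega), by simpa using h.first⟩, rfl⟩, rfl⟩,
      ⟨_, ⟨G k, List.mem_filter.2 ⟨hG k (by omega), by simpa using h.last⟩, rfl⟩, rfl⟩, ?_⟩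
    rintro ⟨i, v⟩ hz
    have hi : i < k := List.mem_range.1 (mem_pairs.1 hz).1
    by_cases hv : (G i).2 = v
    · exact ⟨(i + 1, G (i + 1)), List.mem_append_right _ (List.mem_map_of_mem (List.mem_filter.2
        ⟨hG _ (by omega), by simpa [← hv] using (h.next i hi).symm⟩)), rfl⟩
    · exact ⟨(i, G i), List.mem_append_left _ (List.mem_map_of_mem (List.mem_filter.2
        ⟨hG _ (by omega), by simpa using hv⟩)), rfl⟩

/-- The alternatives for each tuple of values of the universally quantified variables. -/
def matrixClauses (φ : Pi2Formula) (x : Val) (k : ℕ) : List (List (List (ℕ × Gap))) :=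
  (tuples (structUniverse x) φ.p).map fun a =>
    (tuples (pairs (List.range (k + 1)) (gapsOf (tupleList φ.arityX x))) φ.matrix.numAtoms).filter
      fun l => (tuples (structUniverse x) φ.q).any fun b =>
        gapEval φ.matrix x a b (l.map fun z => z.2)

/-- The clauses of the formula to which an instance of the weighted definability problem is
reduced. -/
def pi2Clauses (φ : Pi2Formula) (x : Val) (k : ℕ) : List (List (Bool × List (ℕ × Gap))) :=
  selectionClauses (k + 1) φ.matrix.numAtoms (gapsOf (tupleList φ.arityX x))
    (chainClauses (tupleList φ.arityX x) k) (matrixClauses φ x k)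

theorem PolyTime.structUniverse {x : α → Val} (hx : PolyTime x) :
    PolyTime fun a => structUniverse (x a) := by
  unfold ParamComplexity.structUniverse
  fun_prop

theorem PolyTime.tupleList {x : α → Val} (hx : PolyTime x) (s : ℕ) :
    PolyTime fun a => tupleList s (x a) :=
  .cons (.const _) (.dedup (.tuples (.structUniverse hx) s))

/-- All lengths of enumerated tuples depend on the fixed formula `φ` only, so the enumerations are
polynomial in the instance. -/
theorem polyTime_matrixClauses (φ : Pi2Formula) :
    PolyTime fun z : Val × ℕ => matrixClauses φ z.1 z.2 := by
  have hl : PolyTime fun z : Val × ℕ => tuples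
      (pairs (List.range (z.2 + 1)) (gapsOf (tupleList φ.arityX z.1))) φ.matrix.numAtoms :=
    .tuples (.pairs (by fun_prop) (.gapsOf (.tupleList (.fst .id) _))) _
  refine .map (f := fun z a => (tuples (pairs (List.range (z.2 + 1))
    (gapsOf (tupleList φ.arityX z.1))) φ.matrix.numAtoms).filter
      fun l => (tuples (structUniverse z.1) φ.q).any fun b =>
        gapEval φ.matrix z.1 a b (l.map fun z => z.2)) ?_ (.tuples (.structUniverse (.fst .id)) _)
  refine .filter (f := fun w l => (tuples (structUniverse w.1.1) φ.q).any fun b =>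
        gapEval φ.matrix w.1.1 w.2 b (l.map fun z => z.2)) ?_ (hl.comp (.fst .id))
  refine .any (f := fun (w : ((Val × ℕ) × List Val) × List (ℕ × Gap)) b =>
        gapEval φ.matrix w.1.1.1 w.1.2 b (w.2.map fun z => z.2)) ?_
        (.tuples (.structUniverse (x := fun w : ((Val × ℕ) × List Val) × List (ℕ × Gap) => w.1.1.1)
          (by fun_prop)) _)
  exact (polyTime_gapEval φ.matrix).comp (g := fun w : (((Val × ℕ) × List Val) × List (ℕ × Gap)) ×
    List Val => (w.1.1.1.1, w.1.1.2, w.2, w.1.2.map fun z => z.2)) (by fun_prop)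

theorem polyTime_pi2Clauses (φ : Pi2Formula) :
    PolyTime fun z : Val × ℕ => pi2Clauses φ z.1 z.2 := by
  have h : PolyTime fun z : Val × ℕ => tupleList φ.arityX z.1 := .tupleList (.fst .id) _
  exact .selectionClauses _ (by fun_prop) (.gapsOf h)
    (polyTime_chainClauses.comp (h.prodMk (.snd .id))) (polyTime_matrixClauses φ)

theorem pi2Formula_holds_iff (φ : Pi2Formula) (x : Val) (S : Finset (Fin φ.arityX → Val)) :
    φ.Holds (x.toStructure φ.voc) S ↔ ∀ a ∈ tuples (structUniverse x) φ.p,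
      ∃ b ∈ tuples (structUniverse x) φ.q,
        φ.matrix.Holds (x.toStructure φ.voc) S (listAssignment a b) := by
  have hu : ∀ v, v ∈ (x.toStructure φ.voc).univ ↔ v ∈ structUniverse x := fun v =>
    List.mem_toFinset
  have h1 : ∀ {n : ℕ} (a : Fin n → Val), (∀ i, a i ∈ (x.toStructure φ.voc).univ) →
      List.ofFn a ∈ tuples (structUniverse x) n := by
    intro n a ha
    refine mem_tuples.2 ⟨by simp, fun v hv => ?_⟩
    obtain ⟨i, rfl⟩ := List.mem_ofFn.1 hv
    exact (hu _).1 (ha i)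
  have h2 : ∀ {n : ℕ} {a : List Val}, a ∈ tuples (structUniverse x) n → ∀ i : Fin n,
      a.getD i Val.nil ∈ (x.toStructure φ.voc).univ := by
    intro n a ha i
    obtain ⟨h3, h4⟩ := mem_tuples.1 ha
    rw [List.getD_eq_getElem _ _ (by omega)]
    exact (hu _).2 (h4 _ (List.getElem_mem _))
  have h3 : ∀ {n : ℕ} (a : Fin n → Val), (fun i : Fin n => (List.ofFn a).getD i Val.nil) = a := by
    intro n a
    funext i
    simp
  constructor
  · intro h a ha
    obtain ⟨b, hb, hm⟩ := h _ (h2 ha)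
    refine ⟨List.ofFn b, h1 b hb, ?_⟩
    rwa [listAssignment, h3 b]
  · intro h a ha
    obtain ⟨b, hb, hm⟩ := h _ (h1 a ha)
    refine ⟨fun j => b.getD j Val.nil, h2 hb, ?_⟩
    rwa [listAssignment, h3 a] at hm

theorem listAssignment_mem {U : List Val} {p q : ℕ} {a b : List Val} (ha : a ∈ tuples U p)
    (hb : b ∈ tuples U q) (i : Fin p ⊕ Fin q) : listAssignment a b i ∈ U := by
  obtain ⟨h1, h2⟩ := mem_tuples.1 ha
  obtain ⟨h3, h4⟩ := mem_tuples.1 hb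
  rcases i with i | i
  · simp only [listAssignment, Sum.elim_inl]
    rw [List.getD_eq_getElem _ _ (by omega)]
    exact h2 _ (List.getElem_mem _)
  · simp only [listAssignment, Sum.elim_inr]
    rw [List.getD_eq_getElem _ _ (by omega)]
    exact h4 _ (List.getElem_mem _)

/-- For a set that is represented by a chain of suffixes, a formula holds if and only if some list
of gaps of the chain makes it true. -/
theorem holds_iff_exists_gapEval {τ : Vocabulary} {s p q k : ℕ} (φ : QF τ s (Fin p ⊕ Fin q))
    {x : Val} {S : Finset (Fin s → Val)} {G : ℕ → Gap}
    (hG : IsSuffixChain (tupleList s x) k G)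
    (hS : IsSuffixChain.Represents (tupleList s x) k G [] (S.image List.ofFn)) {a b : List Val}
    (ha : a ∈ tuples (structUniverse x) p) (hb : b ∈ tuples (structUniverse x) q) :
    φ.Holds (x.toStructure τ) S (listAssignment a b) ↔
      ∃ l ∈ tuples (pairs (List.range (k + 1)) (gapsOf (tupleList s x))) φ.numAtoms,
        gapEval φ x a b (l.map fun z => z.2) = true ∧ ∀ z ∈ l, z.2 = G z.1 := by
  have hv : ∀ i, (listAssignment a b : Fin p ⊕ Fin q → Val) i ∈ structUniverse x :=
    listAssignment_mem ha hb
  have hat : ∀ u ∈ φ.atoms (listAssignment a b), u ∈ (tupleList s x).tail := fun u hu =>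
    List.mem_dedup.2 (φ.atoms_subset hv u hu)
  have hnd := nodup_tupleList s x
  -- If the listed gaps belong to the chain and locate every atom, then an atom lies in `S` exactly
  -- when it is the head of a listed gap, so evaluation from the heads is correct.
  have key : ∀ l : List (ℕ × Gap), (∀ z ∈ l, z.1 < k + 1 ∧ z.2 = G z.1) →
      (∀ u ∈ φ.atoms (listAssignment a b), ∃ z ∈ l, u ∈ z.2.1 ∧ u ∉ z.2.2) →
      (φ.eval x ((l.map fun z => z.2).map fun g => g.1.headD []) (listAssignment a b) = true ↔
        φ.Holds (x.toStructure τ) S (listAssignment a b)) := by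
    intro l hl hloc
    refine φ.eval_eq_true_iff hv fun c hc => ?_
    have hmem : c ∈ S ↔ List.ofFn c ∈ S.image List.ofFn := by
      simp [List.ofFn_injective.eq_iff]
    rw [hmem]
    simp only [List.map_map, List.mem_map, Function.comp_apply]
    constructor
    · rintro ⟨z, hz, hzc⟩
      obtain ⟨hzk, hzG⟩ := hl z hz
      rw [hzG] at hzc
      refine (hS z.1 hzk _ ?_ ?_ (hat _ hc)).2 hzc.symm
      · rw [← hzc]
        exact hG.head_mem _ hzk
      · rw [← hzc]
        exact fun h => hG.head_notMem_tail hnd _ hzk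
          ((mem_gapsOf.1 (hG.mem _ hzk)).2.2.subset h)
    · intro hcS
      obtain ⟨z, hz, h1, h2⟩ := hloc _ hc
      obtain ⟨hzk, hzG⟩ := hl z hz
      rw [hzG] at h1 h2
      exact ⟨z, hz, by rw [hzG]; exact ((hS z.1 hzk _ h1 h2 (hat _ hc)).1 hcS).symm⟩
  constructor
  · intro h
    -- Every atom falls into some gap of the chain. One entry for each occurrence gives a list of
    -- length exactly `numAtoms`, possibly with repeated slots.
    have hloc : ∀ u, ∃ i, u ∈ φ.atoms (listAssignment a b) →
        i < k + 1 ∧ u ∈ (G i).1 ∧ u ∉ (G i).2 := by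
      intro u
      by_cases hu : u ∈ φ.atoms (listAssignment a b)
      · obtain ⟨i, hi⟩ := hG.exists_mem (List.mem_of_mem_tail (hat u hu))
        exact ⟨i, fun _ => hi⟩
      · exact ⟨0, fun h => absurd h hu⟩
    choose loc hloc using hloc
    set l := (φ.atoms (listAssignment a b)).map fun u => (loc u, G (loc u)) with hl
    have hl1 : ∀ z ∈ l, z.1 < k + 1 ∧ z.2 = G z.1 := by
      intro z hz
      obtain ⟨u, hu, rfl⟩ := List.mem_map.1 hz
      exact ⟨(hloc u hu).1, rfl⟩
    have hl2 : ∀ u ∈ φ.atoms (listAssignment a b), ∃ z ∈ l, u ∈ z.2.1 ∧ u ∉ z.2.2 := fun u hu =>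
      ⟨_, List.mem_map_of_mem hu, (hloc u hu).2⟩
    refine ⟨l, mem_tuples.2 ⟨by simp [hl, φ.length_atoms], fun z hz => mem_pairs.2
      ⟨List.mem_range.2 (hl1 z hz).1, ?_⟩⟩, ?_, fun z hz => (hl1 z hz).2⟩
    · rw [(hl1 z hz).2]
      exact hG.mem _ (hl1 z hz).1
    · rw [gapEval, Bool.and_eq_true]
      refine ⟨List.all_eq_true.2 fun u hu => List.any_eq_true.2 ?_, (key l hl1 hl2).2 h⟩
      obtain ⟨z, hz, h1, h2⟩ := hl2 u hu
      exact ⟨z.2, List.mem_map_of_mem hz, by simp [h1, h2]⟩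
  · rintro ⟨l, hl, hev, hlG⟩
    rw [gapEval, Bool.and_eq_true, List.all_eq_true] at hev
    refine (key l (fun z hz => ⟨?_, hlG z hz⟩) fun u hu => ?_).1 hev.2
    · exact List.mem_range.1 (mem_pairs.1 ((mem_tuples.1 hl).2 z hz)).1
    · obtain ⟨g, hg, h1⟩ := List.any_eq_true.1 (hev.1 u hu)
      obtain ⟨z, hz, rfl⟩ := List.mem_map.1 hg
      exact ⟨z, hz, by simpa using h1⟩

/-- By `selectionClauses_iff` a hitting set within the budget is a choice `G` of gaps. The chain
clauses make `G` a suffix chain, hence a set of exactly `k` tuples, and the matrix clauses then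
state that this set satisfies `φ`. -/
theorem mem_weightedDef_iff (φ : Pi2Formula) (x : Val) (k : ℕ) :
    (x, k) ∈ weightedDef φ ↔ ∃ H : Finset (Bool × List (ℕ × Gap)),
      H.card ≤ (k + 1) + (k + 1) ^ φ.matrix.numAtoms ∧
        ∀ c ∈ pi2Clauses φ x k, ∃ v ∈ c, v ∈ H := by
  rw [pi2Clauses, selectionClauses_iff]
  rotate_left
  · simp only [chainClauses, List.mem_cons, List.mem_map]
    rintro e (rfl | rfl | ⟨z, hz, rfl⟩) w hw
    · obtain ⟨g, _, rfl⟩ := List.mem_map.1 hw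
      simp
    · obtain ⟨g, _, rfl⟩ := List.mem_map.1 hw
      simp
    · have := List.mem_range.1 (mem_pairs.1 hz).1
      rcases List.mem_append.1 hw with hw | hw
      · obtain ⟨g, _, rfl⟩ := List.mem_map.1 hw
        simp only
        omega
      · obtain ⟨g, _, rfl⟩ := List.mem_map.1 hw
        simp only
        omega
  · simp only [matrixClauses, List.mem_map]
    rintro _ ⟨a, _, rfl⟩ l hl
    exact (List.mem_filter.1 hl).1
  have hmat : ∀ (G : ℕ → Gap) (S : Finset (Fin φ.arityX → Val)),
      IsSuffixChain (tupleList φ.arityX x) k G →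
      IsSuffixChain.Represents (tupleList φ.arityX x) k G [] (S.image List.ofFn) →
      (φ.Holds (x.toStructure φ.voc) S ↔
        ∀ r ∈ matrixClauses φ x k, ∃ l ∈ r, ∀ z ∈ l, z.2 = G z.1) := by
    intro G S hG hS
    rw [pi2Formula_holds_iff]
    simp only [matrixClauses, List.mem_map, forall_exists_index, and_imp,
      forall_apply_eq_imp_iff₂, List.mem_filter, List.any_eq_true]
    refine forall₂_congr fun a ha => ⟨?_, ?_⟩
    · rintro ⟨b, hb, h⟩
      obtain ⟨l, hl, h1, h2⟩ := (holds_iff_exists_gapEval φ.matrix hG hS ha hb).1 h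
      exact ⟨l, ⟨hl, b, hb, h1⟩, h2⟩
    · rintro ⟨l, ⟨hl, b, hb, h1⟩, h2⟩
      exact ⟨b, hb, (holds_iff_exists_gapEval φ.matrix hG hS ha hb).2 ⟨l, hl, h1, h2⟩⟩
  have hnd := nodup_tupleList φ.arityX x
  constructor
  · rintro ⟨S, hSU, hSk, hφ⟩
    simp only at hSk
    have hsub : S.image List.ofFn ⊆ (tuples (structUniverse x) φ.arityX).dedup.toFinset := by
      intro u hu
      obtain ⟨a, ha, rfl⟩ := Finset.mem_image.1 hu
      refine List.mem_toFinset.2 (List.mem_dedup.2 (mem_tuples.2 ⟨by simp, fun v hv => ?_⟩))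
      obtain ⟨i, rfl⟩ := List.mem_ofFn.1 hv
      exact List.mem_toFinset.1 (hSU a ha i)
    obtain ⟨G, hG, hGS⟩ := IsSuffixChain.exists_chain _ _ hnd [] _ hsub
    rw [Finset.card_image_of_injective _ List.ofFn_injective, hSk] at hG hGS
    exact ⟨G, hG.mem, (chainClauses_iff hG.mem).2 hG, (hmat G S hG hGS).1 hφ⟩
  · rintro ⟨G, hmem, hE, hR⟩
    have hG := (chainClauses_iff hmem).1 hE
    obtain ⟨S', hS'T, hS'k, hS'⟩ := hG.exists_finset hnd []
    -- The chain yields a set of lists; all have length `arityX`, so they come from a relation on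
    -- the universe.
    have hrange : (S' : Set (List Val)) ⊆ (List.ofFn : (Fin φ.arityX → Val) → List Val) ''
        {a | ∀ i, a i ∈ structUniverse x} := by
      intro u hu
      have h1 : u ∈ (tuples (structUniverse x) φ.arityX).dedup := List.mem_toFinset.1 (hS'T hu)
      obtain ⟨h2, h3⟩ := mem_tuples.1 (List.mem_dedup.1 h1)
      refine ⟨fun i => u[i], fun i => h3 _ (List.getElem_mem _), ?_⟩
      refine List.ext_getElem (by simp [h2]) fun i _ _ => by simp
    obtain ⟨S, hSU, rfl⟩ := Finset.subset_set_image_iff.1 hrange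
    rw [Finset.card_image_of_injective _ List.ofFn_injective] at hS'k
    exact ⟨S, fun a ha j => List.mem_toFinset.2 (hSU ha j), hS'k, (hmat G S hG hS').2 hR⟩

theorem weakEBackdoor_hard (Q : ParamProblem) (hQ : Q ∈ W2) : FPTReduces Q weakEBackdoor := by
  obtain ⟨φ, hφ⟩ := hQ
  -- The new parameter is computed in unary, as the length of an enumeration of all slots and all
  -- tuples of slots.
  have hk : PolyTime fun z : Val × ℕ =>
      (List.range (z.2 + 1)).length + (tuples (List.range (z.2 + 1)) φ.matrix.numAtoms).length := by
    have h : PolyTime fun z : Val × ℕ => ((List.range (z.2 + 1)).map (fun _ => ()) ++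
        (tuples (List.range (z.2 + 1)) φ.matrix.numAtoms).map fun _ => ()).length := by
      fun_prop
    simpa only [List.length_append, List.length_map] using h
  refine hφ.trans_polyTime (f := fun z => (positiveCNF (pi2Clauses φ z.1 z.2),
    (z.2 + 1) + (z.2 + 1) ^ φ.matrix.numAtoms))
    ((PolyTime.positiveCNF (polyTime_pi2Clauses φ)).prodMk ?_) (φ.matrix.numAtoms + 2) ?_ ?_
  · simpa only [length_tuples, List.length_range] using hk
  · intro x k
    set m := φ.matrix.numAtoms
    have h1 : k + 1 ≤ (k + 2) ^ (m + 1) :=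
      (Nat.le_succ _).trans (Nat.le_self_pow (by omega) _)
    have h2 : (k + 1) ^ m ≤ (k + 2) ^ (m + 1) :=
      (Nat.pow_le_pow_left (by omega) _).trans (Nat.pow_le_pow_right (by omega) (by omega))
    calc (k + 1) + (k + 1) ^ m ≤ (k + 2) ^ (m + 1) * 2 := by omega
      _ ≤ (k + 2) ^ (m + 1) * (k + 2) := Nat.mul_le_mul_left _ (by omega)
  · intro x k
    rw [positiveCNF_mem_weakEBackdoor, mem_weightedDef_iff]

theorem weakEBackdoor_isW2Complete : IsW2Complete weakEBackdoor :=
  ⟨weakEBackdoor_mem_W2, weakEBackdoor_hard⟩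

/-! ### A search tree algorithm for formulas with bounded clauses -/

/-- The clauses that contain no literal from `A`. -/
def openClauses (F : List (List (Literal Val))) (A : List (Literal Val)) :
    List (List (Literal Val)) :=
  F.filter fun c => !c.any fun l => decide (l ∈ A)

/-- The children of a node of the search tree: one more literal from the clause `c` is chosen. -/
def children (r : ℕ) (A c : List (Literal Val)) : List (ℕ × List (Literal Val)) :=
  if decide (r = 0) = true then [] else
    (c.filter fun l => !decide ((l.1, !l.2) ∈ A)).map fun l => (r - 1, l :: A)

/-- The states of the depth first search: the formula, the answer, and the stack of the nodes that
are still to be visited, each with the number of literals that may still be chosen. -/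
abbrev SearchState : Type := List (List (Literal Val)) × Bool × List (ℕ × List (Literal Val))

/-- One step of the depth first search. -/
def searchStep (z : SearchState) : SearchState :=
  if (openClauses z.1 (z.2.2.headD (0, [])).2).isEmpty = true then (z.1, true, [])
  else (z.1, z.2.1, children (z.2.2.headD (0, [])).1 (z.2.2.headD (0, [])).2
    ((openClauses z.1 (z.2.2.headD (0, [])).2).headD []) ++ z.2.2.tail)

theorem polyTime_searchStep : PolyTime searchStep := by
  have h1 : PolyTime fun z : List (List (Literal Val)) × List (Literal Val) =>
      openClauses z.1 z.2 := by
    unfold openClauses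
    fun_prop
  have h2 : PolyTime fun z : ℕ × List (Literal Val) × List (Literal Val) =>
      children z.1 z.2.1 z.2.2 := by
    unfold children
    fun_prop
  have ht : PolyTime fun z : SearchState => z.2.2.headD (0, []) := by fun_prop
  have h3 : PolyTime fun z : SearchState => openClauses z.1 (z.2.2.headD (0, [])).2 :=
    h1.comp (.prodMk (by fun_prop) ht.snd)
  exact .ite h3.isEmpty (by fun_prop) (.prodMk (by fun_prop) (.prodMk (by fun_prop) (.append
    (h2.comp (ht.fst.prodMk (ht.snd.prodMk (h3.headD (.const _))))) (by fun_prop))))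

/-- No literal occurs together with its complement. -/
def Consistent (A : List (Literal Val)) : Prop := ∀ l ∈ A, (l.1, !l.2) ∉ A

/-- The literals in `A` can be completed to a solution by at most `r` literals. -/
def Completable (F : List (List (Literal Val))) (r : ℕ) (A : List (Literal Val)) : Prop :=
  ∃ S : Finset (Literal Val), (∀ l ∈ S, (l.1, !l.2) ∉ S) ∧ (∀ l ∈ A, l ∈ S) ∧
    (S \ A.toFinset).card ≤ r ∧ ∀ c ∈ F, ∃ l ∈ c, l ∈ S

theorem completable_of_openClauses_eq_nil {F : List (List (Literal Val))}
    {A : List (Literal Val)} (hA : Consistent A) (h : openClauses F A = []) (r : ℕ) :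
    Completable F r A := by
  refine ⟨A.toFinset, fun l hl => ?_, fun l hl => List.mem_toFinset.2 hl, by simp, fun c hc => ?_⟩
  · rw [List.mem_toFinset] at hl ⊢
    exact hA l hl
  · have h1 := List.filter_eq_nil_iff.1 h c hc
    rw [Bool.not_eq_true, Bool.not_eq_false', List.any_eq_true] at h1
    obtain ⟨l, hl, hlA⟩ := h1
    exact ⟨l, hl, List.mem_toFinset.2 (of_decide_eq_true hlA)⟩

/-- A solution contains a literal of the open clause `c`. It is not in `A`, so it uses up one of the
`r` free places, and its complement is not in `A` because `A` is part of the consistent solution.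
Conversely, undoing the choice costs at most one place. -/
theorem completable_iff_children {F : List (List (Literal Val))} {A c : List (Literal Val)}
    (hc : c ∈ openClauses F A) (r : ℕ) :
    Completable F r A ↔ ∃ z ∈ children r A c, Completable F z.1 z.2 := by
  have hcF := (List.mem_filter.1 hc).1
  have hcA : ∀ l ∈ c, l ∉ A := by
    simpa using (List.mem_filter.1 hc).2
  constructor
  · rintro ⟨S, hS, hAS, hr, hF⟩
    obtain ⟨l, hl, hlS⟩ := hF c hcF
    have hlA := hcA l hl
    have h1 : l ∈ S \ A.toFinset := by simp [hlS, hlA]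
    have h2 : 0 < r := (Finset.card_pos.2 ⟨l, h1⟩).trans_le hr
    have h3 : S \ (l :: A).toFinset = (S \ A.toFinset).erase l := by
      ext u; simp; tauto
    refine ⟨(r - 1, l :: A), ?_, S, hS, ?_, ?_, hF⟩
    · rw [children, if_neg (by simpa using h2.ne')]
      refine List.mem_map.2 ⟨l, List.mem_filter.2 ⟨hl, ?_⟩, rfl⟩
      simpa using fun h => hS l hlS (hAS _ h)
    · simpa [hlS] using hAS
    · rw [h3, Finset.card_erase_of_mem h1]
      simp only
      omega
  · rintro ⟨z, hz, S, hS, hAS, hr, hF⟩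
    rw [children] at hz
    by_cases h0 : r = 0
    · simp [h0] at hz
    rw [if_neg (by simpa using h0)] at hz
    obtain ⟨l, hl, rfl⟩ := List.mem_map.1 hz
    refine ⟨S, hS, fun u hu => hAS u (List.mem_cons_of_mem _ hu), ?_, hF⟩
    have h3 : S \ A.toFinset ⊆ insert l (S \ (l :: A).toFinset) := by
      intro u; simp; tauto
    have h4 := (Finset.card_le_card h3).trans (Finset.card_insert_le _ _)
    simp only at hr
    omega

/-! ### Size of the search tree and shape of the stack -/

/-- The number of nodes of a complete `d`-ary tree of height `r`. -/
def treeSize (d : ℕ) : ℕ → ℕ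
  | 0 => 1
  | r + 1 => d * treeSize d r + 1

/-- Each of the `r + 1` levels has at most `d ^ r` nodes. The factor `r + 1` is attained for `d = 1`
and is later absorbed by the polynomial. -/
theorem treeSize_le {d : ℕ} (hd : 1 ≤ d) (r : ℕ) : treeSize d r ≤ (r + 1) * d ^ r := by
  induction r with
  | zero => simp [treeSize]
  | succ r ih =>
    have h1 : 1 ≤ d ^ (r + 1) := Nat.one_le_pow _ _ hd
    calc treeSize d (r + 1) = d * treeSize d r + 1 := rfl
      _ ≤ d * ((r + 1) * d ^ r) + d ^ (r + 1) := by gcongr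
      _ = _ := by ring

/-- A bound on the number of steps that are needed for a stack. -/
def stackWeight (d : ℕ) (s : List (ℕ × List (Literal Val))) : ℕ :=
  (s.map fun z => treeSize d z.1).sum

/-- A node of the search tree for parameter `k`. -/
def IsNode (F : List (List (Literal Val))) (k : ℕ) (z : ℕ × List (Literal Val)) : Prop :=
  z.2.length + z.1 ≤ k ∧ (∀ l ∈ z.2, l ∈ F.flatten) ∧ Consistent z.2

/-- The stack contains nodes only, and it is not longer than it can be in a depth first search. -/
def IsStack (d : ℕ) (F : List (List (Literal Val))) (k : ℕ) : List (ℕ × List (Literal Val)) → Prop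
  | [] => True
  | z :: s => IsNode F k z ∧ s.length ≤ d * (k - z.1) ∧ IsStack d F k s

theorem IsStack.isNode {d k : ℕ} {F : List (List (Literal Val))}
    {s : List (ℕ × List (Literal Val))} (h : IsStack d F k s) : ∀ z ∈ s, IsNode F k z := by
  induction s with
  | nil => simp
  | cons z s ih =>
    intro w hw
    rcases List.mem_cons.1 hw with rfl | hw
    exacts [h.1, ih h.2.2 w hw]

theorem IsStack.length_le {d k : ℕ} {F : List (List (Literal Val))}
    {s : List (ℕ × List (Literal Val))} (h : IsStack d F k s) : s.length ≤ d * k + 1 := by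
  cases s with
  | nil => simp
  | cons z s =>
    have h1 : d * (k - z.1) ≤ d * k := Nat.mul_le_mul_left _ (Nat.sub_le _ _)
    have h2 := h.2.1
    simp only [List.length_cons]
    omega

/-- The new nodes share the budget `r`, so one bound on the total length covers the condition at
each of them. -/
theorem IsStack.append {d k r : ℕ} {F : List (List (Literal Val))}
    {s s' : List (ℕ × List (Literal Val))} (hs : IsStack d F k s)
    (hs' : ∀ z ∈ s', IsNode F k z ∧ z.1 = r) (hlen : s'.length + s.length ≤ d * (k - r)) :
    IsStack d F k (s' ++ s) := by
  induction s' with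
  | nil => exact hs
  | cons z s' ih =>
    simp only [List.length_cons] at hlen
    obtain ⟨h1, h2⟩ := hs' z List.mem_cons_self
    refine ⟨h1, ?_, ih (fun w hw => hs' w (List.mem_cons_of_mem _ hw)) (by omega)⟩
    rw [h2, List.append_eq, List.length_append]
    omega

theorem mem_children {r : ℕ} {A c : List (Literal Val)} {z : ℕ × List (Literal Val)} :
    z ∈ children r A c ↔ r ≠ 0 ∧ ∃ l ∈ c, (l.1, !l.2) ∉ A ∧ z = (r - 1, l :: A) := by
  rw [children]
  by_cases h0 : r = 0
  · simp [h0]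
  · rw [if_neg (by simpa using h0)]
    simp only [List.mem_map, List.mem_filter, ne_eq, h0, not_false_eq_true, true_and, and_assoc,
      Bool.not_eq_true', decide_eq_false_iff_not, @eq_comm _ z]

theorem length_children_le (r : ℕ) (A c : List (Literal Val)) :
    (children r A c).length ≤ c.length := by
  rw [children]
  split_ifs
  · simp
  · simpa using List.length_filter_le _ _

theorem isNode_of_mem_children {F : List (List (Literal Val))} {k r : ℕ} {A c : List (Literal Val)}
    (h : IsNode F k (r, A)) (hc : c ∈ F) {z : ℕ × List (Literal Val)} (hz : z ∈ children r A c) :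
    IsNode F k z ∧ z.1 = r - 1 := by
  obtain ⟨h0, l, hl, hlA, rfl⟩ := mem_children.1 hz
  obtain ⟨h1, h2, h3⟩ := h
  refine ⟨⟨?_, ?_, ?_⟩, rfl⟩
  · simp only [List.length_cons] at h1 ⊢
    omega
  · intro u hu
    rcases List.mem_cons.1 hu with rfl | hu
    exacts [List.mem_flatten.2 ⟨c, hc, hl⟩, h2 u hu]
  · intro u hu hu'
    rcases List.mem_cons.1 hu with rfl | hu
    · rcases List.mem_cons.1 hu' with h4 | h4
      · have := congrArg Prod.snd h4
        simp at this
      · exact hlA h4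
    · rcases List.mem_cons.1 hu' with h4 | h4
      · apply hlA
        rw [← h4]
        simpa using hu
      · exact h3 u hu h4

/-- Replacing a node by its children lowers the weight of the stack by at least one; this bounds the
number of iterations. -/
theorem stackWeight_children_le (d r : ℕ) {A c : List (Literal Val)} (hc : c.length ≤ d) :
    stackWeight d (children r A c) + 1 ≤ treeSize d r := by
  cases r with
  | zero => simp [children, stackWeight, treeSize]
  | succ r =>
    have h1 : ((children (r + 1) A c).map fun z => treeSize d z.1) =
        List.replicate (children (r + 1) A c).length (treeSize d r) := by
      refine List.eq_replicate_iff.2 ⟨by simp, fun w hw => ?_⟩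
      obtain ⟨z, hz, rfl⟩ := List.mem_map.1 hw
      obtain ⟨_, l, _, _, rfl⟩ := mem_children.1 hz
      rfl
    rw [stackWeight, h1, List.sum_replicate, smul_eq_mul, treeSize]
    exact Nat.add_le_add_right (Nat.mul_le_mul_right _ ((length_children_le _ _ _).trans hc)) 1

/-- The depth first search gives the correct answer, and the number of its steps is bounded by the
weight of the stack. -/
theorem runs_search {d k K : ℕ} {c p : Prog} {F : List (List (Literal Val))}
    (hF : ∀ a ∈ F, a.length ≤ d)
    (hc : ∀ (b : Bool) s, IsStack d F k s → ∃ t ≤ K,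
      Runs c (enc (F, b, s)) (enc (!s.isEmpty)) t)
    (hp : ∀ (b : Bool) s, IsStack d F k s → ∃ t ≤ K,
      Runs p (enc (F, b, s)) (enc (searchStep (F, b, s))) t)
    (N : ℕ) (b : Bool) (s : List (ℕ × List (Literal Val))) (hs : IsStack d F k s)
    (hN : stackWeight d s ≤ N) :
    ∃ b' t, Runs (Prog.loop c p) (enc (F, b, s))
        (enc (F, b', ([] : List (ℕ × List (Literal Val))))) t ∧
      t ≤ (N + 1) * (2 * K + 1) ∧
      (b' = true ↔ b = true ∨ ∃ z ∈ s, Completable F z.1 z.2) := by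
  induction N generalizing b s with
  | zero =>
    cases s with
    | nil =>
      obtain ⟨t, htK, ht⟩ := hc b [] hs
      exact ⟨b, _, Runs.loop_stop ht, by omega, by simp⟩
    | cons z s =>
      exfalso
      have : 1 ≤ treeSize d z.1 := by cases z.1 <;> simp [treeSize]
      simp only [stackWeight, List.map_cons, List.sum_cons] at hN
      omega
  | succ N ih =>
    cases s with
    | nil =>
      obtain ⟨t, htK, ht⟩ := hc b [] hs
      refine ⟨b, _, Runs.loop_stop ht, ?_, by simp⟩
      have : 1 * (2 * K + 1) ≤ (N + 1 + 1) * (2 * K + 1) := Nat.mul_le_mul_right _ (by omega)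
      omega
    | cons z s =>
      obtain ⟨t, htK, ht⟩ := hc b (z :: s) hs
      obtain ⟨u, huK, hu⟩ := hp b (z :: s) hs
      obtain ⟨r, A⟩ := z
      obtain ⟨hnode, hlen, hs'⟩ := hs
      have htime : ∀ v, v ≤ (N + 1) * (2 * K + 1) → t + u + v + 1 ≤ (N + 1 + 1) * (2 * K + 1) := by
        intro v hv
        rw [Nat.add_mul (N + 1) 1]
        omega
      by_cases hopen : openClauses F A = []
      · have hstep : searchStep (F, b, (r, A) :: s) = (F, true, []) := by
          simp [searchStep, hopen]
        rw [hstep] at hu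
        obtain ⟨b', v, hv, hvK, hb'⟩ := ih true [] trivial (by simp [stackWeight])
        refine ⟨b', _, Runs.loop_step ht (by simp) hu hv, htime v hvK, ?_⟩
        have := completable_of_openClauses_eq_nil hnode.2.2 hopen r
        simp [hb', this]
      · obtain ⟨a, ha⟩ : ∃ a, (openClauses F A).headD [] = a := ⟨_, rfl⟩
        have haF : a ∈ openClauses F A := by
          rw [← ha, ← headD_cons_tail hopen []]
          exact List.mem_cons_self
        have hstep : searchStep (F, b, (r, A) :: s) = (F, b, children r A a ++ s) := by
          rw [searchStep]
          simp only [List.headD_cons, ha, List.tail_cons]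
          rw [if_neg (by simpa using hopen)]
        rw [hstep] at hu
        have haF' := (List.mem_filter.1 haF).1
        have hchild := length_children_le r A a
        have had := hF a haF'
        -- At most `d` children appear, and their budget `r - 1` raises the admissible stack length
        -- by exactly `d`. For `r = 0` there are no children.
        have hstack : IsStack d F k (children r A a ++ s) := by
          refine hs'.append (r := r - 1) (fun w hw => isNode_of_mem_children hnode haF' hw) ?_
          rcases Nat.eq_zero_or_pos r with rfl | h0
          · simpa [children] using hlen
          · have h1 : r ≤ k := (Nat.le_add_left _ _).trans hnode.1
            have h2 : k - (r - 1) = (k - r) + 1 := by omega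
            simp only at hlen
            rw [h2, Nat.mul_add]
            omega
        obtain ⟨b', v, hv, hvK, hb'⟩ := ih b _ hstack (by
          have h1 := stackWeight_children_le d r (A := A) had
          simp only [stackWeight, List.map_append, List.sum_append, List.map_cons,
            List.sum_cons] at h1 hN ⊢
          omega)
        refine ⟨b', _, Runs.loop_step ht (by simp) hu hv, htime v hvK, ?_⟩
        rw [hb']
        simp only [List.mem_append, List.mem_cons, or_and_right, exists_or, exists_eq_left]
        rw [completable_iff_children haF r]

/-! ### The time bound for the search -/

theorem esize_nat (n : ℕ) : esize n = 2 * n + 1 := by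
  induction n with
  | zero => rfl
  | succ n ih =>
    have : esize (n + 1) = 1 + esize n + 1 := rfl
    omega

/-- There are at most `d * k + 1` nodes, each with at most `k` literals of `F`. Thus the state stays
polynomial although the search tree is not. -/
theorem IsStack.esize_le {d k : ℕ} {F : List (List (Literal Val))}
    {s : List (ℕ × List (Literal Val))} (h : IsStack d F k s) :
    esize s ≤ (d * k + 1) * (2 * k + 1 + (k * (esize F + 1) + 1) + 1 + 1) + 1 := by
  refine esize_le_of_length_le h.length_le fun z hz => ?_
  obtain ⟨h1, h2, -⟩ := h.isNode z hz
  have h3 : esize z.2 ≤ k * (esize F + 1) + 1 := by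
    refine esize_le_of_length_le (by omega) fun l hl => ?_
    obtain ⟨c, hc, hlc⟩ := List.mem_flatten.1 (h2 l hl)
    exact (esize_le_of_mem hlc).trans (esize_le_of_mem hc)
  have h4 : esize z = esize z.1 + esize z.2 + 1 := rfl
  rw [h4, esize_nat]
  omega

/-- Clauses are sets, while their codes may repeat literals; only after `dedup` does the list length
bound the branching by `d`. -/
theorem mem_weakEBackdoorDCNF {d : ℕ} {x : Val} {k : ℕ} : (x, k) ∈ weakEBackdoorDCNF d ↔
    (∀ c ∈ (parseCNF x).map List.dedup, c.length ≤ d) ∧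
      Completable ((parseCNF x).map List.dedup) k [] := by
  refine and_congr ?_ (mem_weakEBackdoor_iff_parseCNF.trans ?_)
  · simp only [CNF.IsDCNF, mem_toCNF, forall_exists_index, and_imp, forall_apply_eq_imp_iff₂,
      List.card_toFinset, List.mem_map]
  · refine exists_congr fun S => ?_
    simp only [List.mem_map, forall_exists_index, and_imp, forall_apply_eq_imp_iff₂, List.mem_dedup,
      List.not_mem_nil, false_implies, implies_true, true_and, List.toFinset_nil,
      Finset.sdiff_empty]
    tauto

theorem weakEBackdoorDCNF_solvable {d : ℕ} (hd : 1 ≤ d) :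
    SolvableInOStar (weakEBackdoorDCNF d) fun k => d ^ k := by
  set F : Val × ℕ → List (List (Literal Val)) := fun z => (parseCNF z.1).map List.dedup with hFdef
  have hF : PolyTime F := .map (f := fun _ c => c.dedup) (.dedup (.snd .id)) (.parseCNF (.fst .id))
  have hFs := hF.esize_bdd
  obtain ⟨c, gc, ⟨ec, hgc⟩, hc⟩ : PolyTime fun z : SearchState => !z.2.2.isEmpty := by fun_prop
  obtain ⟨p, gp, ⟨ep, hgp⟩, hp⟩ := polyTime_searchStep
  obtain ⟨q, gq, hgq, hq⟩ : PolyTime fun z : Val × ℕ =>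
      (F z, false, [(z.2, ([] : List (Literal Val)))]) :=
    .prodMk hF (by fun_prop)
  -- The comparison with the constant `d` is expressed as membership in a constant list, which
  -- reduces to equality tests.
  obtain ⟨r, gr, hgr, hr⟩ : PolyTime fun z : Val × ℕ =>
      (F z).all fun c => decide (c.length ∈ List.range (d + 1)) :=
    .all (f := fun _ c => decide (c.length ∈ List.range (d + 1))) (by fun_prop) hF
  have hk : PolyBdd fun z : Val × ℕ => z.2 := PolyBdd.size.mono fun z => by
    have : esize z = esize z.1 + esize z.2 + 1 := rfl
    rw [this, esize_nat]
    omega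
  have one := fun n => PolyBdd.const (α := Val × ℕ) n
  -- a bound on the size of the states
  set M : Val × ℕ → ℕ := fun z => esize (F z) +
    ((d * z.2 + 1) * (2 * z.2 + 1 + (z.2 * (esize (F z) + 1) + 1) + 1 + 1) + 1) + 10 with hMdef
  have hM : PolyBdd M := by
    refine (hFs.add (((((one d).mul hk).add (one 1)).mul ?_).add (one 1))).add (one 10)
    exact ((((((one 2).mul hk).add (one 1)).add ((hk.mul (hFs.add (one 1))).add (one 1))).add
      (one 1)).add (one 1))
  set K : Val × ℕ → ℕ := fun z => (M z + 2) ^ ec + (M z + 2) ^ ep with hKdef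
  have hK : PolyBdd K := ((hM.add (one 2)).pow ec).add ((hM.add (one 2)).pow ep)
  obtain ⟨e, he⟩ : PolyBdd fun z =>
      gr z + gq z + (z.2 + 2) * (2 * K z + 1) + 2 * M z + esize z + 20 :=
    ((((hgr.add hgq).add ((hk.add (one 2)).mul (((one 2).mul hK).add (one 1)))).add
      ((one 2).mul hM)).add PolyBdd.size).add (one 20)
  -- Check the clause lengths, build the initial state, search, and read the answer from the final
  -- state. The constant `3 ^ e` comes from `esize + 2 ≤ 3 * size`.
  refine ⟨Prog.cond r (Prog.seq q (Prog.seq (Prog.loop c p) (Prog.seq Prog.tl Prog.hd))) Prog.nil,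
    3 ^ e, e, fun x k => ?_⟩
  have hd1 : 1 ≤ d ^ k := Nat.one_le_pow _ _ hd
  have hbound : ∀ t, t ≤ d ^ k * (gr (x, k) + gq (x, k) + (k + 2) * (2 * K (x, k) + 1) +
      2 * M (x, k) + esize (x, k) + 20) → t ≤ 3 ^ e * d ^ k * (input x k).size ^ e := by
    intro t ht
    have h1 := (input x k).one_le_size
    have h2 : esize (x, k) + 2 ≤ 3 * (input x k).size := by
      have : esize (x, k) = (input x k).size := rfl
      omega
    calc t ≤ d ^ k * (3 * (input x k).size) ^ e :=
          ht.trans (Nat.mul_le_mul_left _ ((he (x, k)).trans (Nat.pow_le_pow_left h2 e)))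
      _ = _ := by ring
  obtain ⟨t, ht, htg⟩ := hr (x, k)
  rw [mem_weakEBackdoorDCNF]
  by_cases hdc : ∀ c ∈ (parseCNF x).map List.dedup, c.length ≤ d
  · have hall : (F (x, k)).all (fun c => decide (c.length ∈ List.range (d + 1))) = true := by
      refine List.all_eq_true.2 fun c hc => ?_
      simpa [Nat.lt_succ_iff] using hdc c hc
    simp only [hall] at ht
    obtain ⟨u, hu, hug⟩ := hq (x, k)
    have hsize : ∀ (b : Bool) s, IsStack d (F (x, k)) k s →
        esize (F (x, k), b, s) + 2 ≤ M (x, k) + 2 := by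
      intro b s hs
      have h1 := hs.esize_le
      have h2 : esize b ≤ 3 := by cases b <;> decide
      simp only [esize_mk, hMdef]
      omega
    have hcK : ∀ (b : Bool) s, IsStack d (F (x, k)) k s → ∃ t ≤ K (x, k),
        Runs c (enc (F (x, k), b, s)) (enc (!s.isEmpty)) t := by
      intro b s hs
      obtain ⟨t, ht, htg⟩ := hc (F (x, k), b, s)
      refine ⟨t, ?_, ht⟩
      exact (htg.trans (hgc _)).trans ((Nat.pow_le_pow_left (hsize b s hs) _).trans
        (Nat.le_add_right _ _))
    have hpK : ∀ (b : Bool) s, IsStack d (F (x, k)) k s → ∃ t ≤ K (x, k),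
        Runs p (enc (F (x, k), b, s)) (enc (searchStep (F (x, k), b, s))) t := by
      intro b s hs
      obtain ⟨t, ht, htg⟩ := hp (F (x, k), b, s)
      refine ⟨t, ?_, ht⟩
      exact (htg.trans (hgp _)).trans ((Nat.pow_le_pow_left (hsize b s hs) _).trans
        (Nat.le_add_left _ _))
    obtain ⟨b, v, hv, hvK, hb⟩ := runs_search hdc hcK hpK (treeSize d k) false [(k, [])]
      ⟨⟨by simp, by simp, by simp [Consistent]⟩, by simp, trivial⟩ (by simp [stackWeight])
    have hfin := Runs.seq (Runs.tl (enc (F (x, k), b, ([] : List (ℕ × List (Literal Val))))))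
      (Runs.hd _)
    refine ⟨enc b, _, Runs.cond_true ht (by simp) (Runs.seq hu (Runs.seq hv hfin)), hbound _ ?_, ?_⟩
    -- Only the loop contributes the factor `d ^ k`; all other costs are polynomial and are
    -- multiplied by `d ^ k ≥ 1` merely to fit the common bound.
    · have h1 : treeSize d k + 1 ≤ d ^ k * (k + 2) := by
        have := treeSize_le hd k
        calc treeSize d k + 1 ≤ (k + 1) * d ^ k + d ^ k := by omega
          _ = _ := by ring
      have h2 : v ≤ d ^ k * ((k + 2) * (2 * K (x, k) + 1)) :=
        hvK.trans ((Nat.mul_le_mul_right _ h1).trans (by rw [mul_assoc]))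
      have h3 : ∀ n, n ≤ d ^ k * n := fun n => Nat.le_mul_of_pos_left n hd1
      have h4 := hsize b [] trivial
      have h5 := Val.size_tl_le (enc (F (x, k), b, ([] : List (ℕ × List (Literal Val)))))
      have h6 := h3 (gr (x, k) + gq (x, k) + 2 * M (x, k) + esize (x, k) + 20)
      have h7 : d ^ k * (gr (x, k) + gq (x, k) + (k + 2) * (2 * K (x, k) + 1) +
          2 * M (x, k) + esize (x, k) + 20) = d ^ k * ((k + 2) * (2 * K (x, k) + 1)) +
          d ^ k * (gr (x, k) + gq (x, k) + 2 * M (x, k) + esize (x, k) + 20) := by ring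
      rw [h7]
      simp only [esize] at h4 h6 ⊢
      omega
    · have h1 : enc b ≠ Val.nil ↔ b = true := by cases b <;> simp
      rw [h1, hb]
      simp only [Bool.false_eq_true, List.mem_singleton, exists_eq_left, false_or]
      exact ⟨fun h => ⟨hdc, h⟩, fun h => h.2⟩
  · have hall : (F (x, k)).all (fun c => decide (c.length ∈ List.range (d + 1))) = false := by
      rw [Bool.eq_false_iff]
      intro h
      refine hdc fun c hc => ?_
      simpa [Nat.lt_succ_iff] using List.all_eq_true.1 h c hc
    simp only [hall] at ht
    refine ⟨_, _, Runs.cond_false ht (Runs.nil _), hbound _ ?_,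
      iff_of_false (by simp) fun h => hdc h.1⟩
    refine le_trans ?_ (Nat.le_mul_of_pos_left _ hd1)
    have h1 : (input x k).size = esize (x, k) := rfl
    have h2 : (enc (x, k)).size = esize (x, k) := rfl
    omega

theorem weakEBackdoorDCNF_isFPT {d : ℕ} (hd : 1 ≤ d) : IsFPT (weakEBackdoorDCNF d) :=
  ⟨fun k => d ^ k, computable_const_pow d, weakEBackdoorDCNF_solvable hd⟩

end ParamComplexity

theorem mainTheorem2 :
    ParamComplexity.IsW2Complete ParamComplexity.weakEBackdoor ∧
    ParamComplexity.FPTReduces ParamComplexity.hittingSet ParamComplexity.weakEBackdoor ∧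
    ∀ d : ℕ, 1 ≤ d →
      ParamComplexity.IsFPT (ParamComplexity.weakEBackdoorDCNF d) ∧
      ParamComplexity.SolvableInOStar (ParamComplexity.weakEBackdoorDCNF d) (fun k => d ^ k) :=
  ⟨ParamComplexity.weakEBackdoor_isW2Complete, ParamComplexity.hittingSet_fptReduces,
    fun _ hd => ⟨ParamComplexity.weakEBackdoorDCNF_isFPT hd,
      ParamComplexity.weakEBackdoorDCNF_solvable hd⟩⟩
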